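/- Let $q$ be a prime power. For a linear code $C\subseteq\mathbb F_{q^2}^n$ let $C^{\perp_H}=\{u:\sum_i u_iv_i^q=0\ \forall v\in C\}$ be its Hermitian dual and $\mathrm{Hull}_H(C)=C\cap C^{\perp_H}$ its Hermitian hull. An $[[n,\kappa,\delta;c]]_q$ entanglement-assisted quantum error-correcting code (EAQECC) encodes $\kappa$ logical qudits of dimension $q$ into $n$ physical qudits with the help of $n-\kappa-c$ ancillas and $c$ maximally entangled pairs of qudits, shared with a receiver whose $c$ qudits are free of errors, and has minimum distance $\delta$. Call it optimal if its parameters are those obtained by the Hermitian construction from some linear code $C$ over $\mathbb F_{q^2}$ of length $n$, that is, $c=\dim C-\dim\mathrm{Hull}_H(C)$, $\kappa=n-2\dim C+c$ and $\delta$ is the least weight of a nonzero vector in $C^{\perp_H}\setminus\mathrm{Hull}_H(C)$, and if $2\delta=n+c-\kappa+2$. Then there exist optimal $[[n,\kappa,\delta;c]]_q$ EAQECCs, for which $C$ can be taken to be a generalized Reed--Solomon code, with the following parameters. (A) For every integer $s$ with $0\le s\le q-1$: 1. $[[q^2-s,\ 1,\ q^2-q+1;\ q^2-2q+1+s]]_q$,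 2. $[[q^2-s,\ 1+s,\ q^2-q+1-s;\ q^2-2q+1]]_q$, 3. $[[q^2-s,\ q^2-2q+1,\ q+1;\ 1+s]]_q$, 4. $[[q^2-s,\ q^2-2q+1+s,\ q+1-s;\ 1]]_q$. (B) For all integers $k,s$ with $1<k<q$ and $0\le s\le k-1$: 5. $[[q^2-1-s,\ 1,\ q^2-k;\ q^2-2k+s]]_q$, 6. $[[q^2-1-s,\ 1+s,\ q^2-k-s;\ q^2-2k]]_q$, 7. $[[q^2-1-s,\ q^2-2k,\ k+1;\ 1+s]]_q$, 8. $[[q^2-1-s,\ q^2-2k+s,\ k+1-s;\ 1]]_q$. (C) For all integers $k,s$ with $1<k<q$ and $0\le s\le k-1$, with $i=\gcd(k-1,q-1)$ and $N=q^2-i(q+1)$: 9. $[[N-s,\ 1,\ N-k+1;\ N-2k+1+s]]_q$, 10. $[[N-s,\ 1+s,\ N-k+1-s;\ N-2k+1]]_q$, 11. $[[N-s,\ N-2k+1,\ k+1;\ 1+s]]_q$, 12. $[[N-s,\ N-2k+1+s,\ k+1-s;\ 1]]_q$. (D) For all integers $k,m,s$ with $1<k<q$, $k-1<m<q-1$ and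 $0\le s\le k-1$, with $j=\gcd(m-k+1,q-1)$ and $M=q^2-j(q+1)$: 13. $[[M-1-s,\ 1,\ M-k;\ M-2k+s]]_q$, 14. $[[M-1-s,\ 1+s,\ M-k-s;\ M-2k]]_q$, 15. $[[M-1-s,\ M-2k,\ k+1;\ 1+s]]_q$, 16. $[[M-1-s,\ M-2k+s,\ k+1-s;\ 1]]_q$. -/

import Mathlib

open scoped Kronecker

/-! ### Linear codes over the field with `q ^ 2` elements -/

section LinearCodes

variable {F : Type*} [Field F]

/-- The Hermitian inner product `∑ i, u i * (v i) ^ q`, for `F` the field with `q ^ 2` elements. -/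
def hermInner (q : ℕ) {n : ℕ} (u v : Fin n → F) : F := ∑ i, u i * v i ^ q

/-- The Hermitian dual of a linear code. -/
def hermDual (q : ℕ) {n : ℕ} (C : Submodule F (Fin n → F)) : Submodule F (Fin n → F) where
  carrier := {u | ∀ v ∈ C, hermInner q u v = 0}
  zero_mem' := by
    intro v _
    simp [hermInner]
  add_mem' := by
    intro u w hu hw v hv
    have h : hermInner q (u + w) v = hermInner q u v + hermInner q w v := by
      simp [hermInner, add_mul, Finset.sum_add_distrib]
    rw [h, hu v hv, hw v hv, add_zero]
  smul_mem' := by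
    intro a u hu v hv
    have h : hermInner q (a • u) v = a * hermInner q u v := by
      simp [hermInner, Finset.mul_sum, mul_assoc]
    rw [h, hu v hv, mul_zero]

/-- The Hermitian hull: the intersection of a code with its Hermitian dual. -/
def hermHull (q : ℕ) {n : ℕ} (C : Submodule F (Fin n → F)) : Submodule F (Fin n → F) :=
  C ⊓ hermDual q C

/-- The set of the Hamming weights of the nonzero vectors of `S`. The weight `wt(S)` of `S` is the
least element of this set. -/
def weightSet {n : ℕ} (S : Set (Fin n → F)) : Set ℕ :=
  {w | ∃ u ∈ S, u ≠ 0 ∧ Set.ncard {i | u i ≠ 0} = w}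

/-- The generalized Reed-Solomon code of all `(a i * f (b i))_i` with `f` a polynomial of degree
less than `k`. -/
noncomputable def grsCode {n : ℕ} (k : ℕ) (b a : Fin n → F) : Submodule F (Fin n → F) :=
  (Polynomial.degreeLT F k).map (LinearMap.pi fun i => a i • Polynomial.leval (b i))

/-- `C` is a generalized Reed-Solomon code: distinct evaluation points `b i`, nonzero column
multipliers `a i`, and dimension `k` at most the length. -/
def IsGRS {n : ℕ} (C : Submodule F (Fin n → F)) : Prop :=
  ∃ k ≤ n, ∃ b a : Fin n → F, Function.Injective b ∧ (∀ i, a i ≠ 0) ∧ C = grsCode k b a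

end LinearCodes

/-! ### Entanglement-assisted quantum error-correcting codes

The space of `n` qudits is the space of complex functions on `Fin n → Fin q`, with the
computational basis indexed by `Fin n → Fin q`. Operators are given by their matrices. -/

/-- The state of `c` pairs of maximally entangled qudits, half of each pair held by the sender (first
argument) and half by the receiver (second argument): `q ^ (-c / 2) * ∑ e, |e⟩ ⊗ |e⟩`. -/
noncomputable def maxEntangled (q c : ℕ) (e b : Fin c → Fin q) : ℂ :=
  if e = b then ((Real.sqrt ((q : ℝ) ^ c))⁻¹ : ℝ) else 0

/-- A `q`-ary entanglement-assisted code with `κ` logical qudits, `n` physical qudits and `c` pairs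
of maximally entangled qudits. The sender applies an encoding operation to the `κ` logical qudits,
the sender's halves of the `c` pairs and `n - κ - c` ancillas in the state `|0⟩`. A unitary map of
the `n` qudits restricted to such inputs is the same thing as an isometry `V` from `κ + c` qudits
to `n` qudits (so that `κ + c ≤ n` when `2 ≤ q`). -/
structure EAQECC (q n κ c : ℕ) where
  /-- The encoding map of the sender. -/
  V : Matrix (Fin n → Fin q) ((Fin κ → Fin q) × (Fin c → Fin q)) ℂ
  isometry : V.conjTranspose * V = 1

namespace EAQECC

variable {q n κ c : ℕ}

/-- The map `φ ↦ (V ⊗ 1) (φ ⊗ Φ)` from logical states to states of `n + c` qudits, the last `c` of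
which are held by the receiver, where `Φ` is the maximally entangled state. -/
noncomputable def encode (Q : EAQECC q n κ c) :
    Matrix ((Fin n → Fin q) × (Fin c → Fin q)) (Fin κ → Fin q) ℂ :=
  fun y φ => ∑ e, Q.V y.1 (φ, e) * maxEntangled q c e y.2

end EAQECC

/-- The operator on `n` qudits that acts as `A` on the qudits with position in `T` and as the
identity on the others. -/
noncomputable def localOp {q n : ℕ} (T : Finset (Fin n))
    (A : Matrix (T → Fin q) (T → Fin q) ℂ) : Matrix (Fin n → Fin q) (Fin n → Fin q) ℂ :=
  open Classical in
  fun x y => if ∀ i, i ∉ T → x i = y i then A (fun i => x i) (fun i => y i) else 0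

namespace EAQECC

variable {q n κ c : ℕ}

/-- The code detects every error on fewer than `d` of the `n` physical qudits, the receiver's
`c` qudits being free of errors: `P (E ⊗ 1) P` is a multiple of `P`, for `P` the projection on
the code space, written with the isometry `encode` whose range is the code space. -/
def DetectsBelow (Q : EAQECC q n κ c) (d : ℕ) : Prop :=
  ∀ T : Finset (Fin n), T.card < d → ∀ A : Matrix (T → Fin q) (T → Fin q) ℂ, ∃ z : ℂ,
    Q.encode.conjTranspose *
      (localOp T A ⊗ₖ (1 : Matrix (Fin c → Fin q) (Fin c → Fin q) ℂ)) * Q.encode = z • 1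

/-- The minimum distance of the code is exactly `δ`: all errors on fewer than `δ` qudits are
detected, and some error on at most `δ` qudits is not. So `Q` is an `[[n, κ, δ; c]]_q` code. -/
def HasDistance (Q : EAQECC q n κ c) (δ : ℕ) : Prop :=
  Q.DetectsBelow δ ∧ ¬ Q.DetectsBelow (δ + 1)

/-- `Q` is an `[[n, κ, δ; c]]_q` code with the parameters that the linear code `C` over the field
`F` with `q ^ 2` elements gives in the Hermitian construction:
`c = dim C - dim Hull(C)`, `κ = n - 2 dim C + c` and `δ = wt(Cᗮ \ Hull(C))`. -/
def HasParamsOf {F : Type*} [Field F] (Q : EAQECC q n κ c) (δ : ℕ)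
    (C : Submodule F (Fin n → F)) : Prop :=
  (c : ℤ) = Module.finrank F C - Module.finrank F (hermHull q C) ∧
  (κ : ℤ) = n - 2 * Module.finrank F C + c ∧
  IsLeast (weightSet ((hermDual q C : Set (Fin n → F)) \ (hermHull q C : Set (Fin n → F)))) δ ∧
  Q.HasDistance δ

end EAQECC

/-- There is an optimal `[[n, κ, δ; c]]_q` entanglement-assisted code that comes from a generalized
Reed-Solomon code over `F` (the field with `q ^ 2` elements) by the Hermitian construction.
Optimal means equality in the bound `2 δ ≤ n + c - κ + 2`. The parameters are integers, so that no
subtraction is truncated; they have to be natural numbers. -/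
def ExistsOptimalEAQECC (F : Type*) [Field F] (q : ℕ) (n κ δ c : ℤ) : Prop :=
  ∃ n' κ' δ' c' : ℕ, (n' : ℤ) = n ∧ (κ' : ℤ) = κ ∧ (δ' : ℤ) = δ ∧ (c' : ℤ) = c ∧
    (∃ C : Submodule F (Fin n' → F), IsGRS C ∧ ∃ Q : EAQECC q n' κ' c', Q.HasParamsOf δ' C) ∧
    2 * δ = n + c - κ + 2

/-! ### Weyl systems -/

/-! Two arguments meet here: a proof that the Hermitian construction yields genuine quantum codes,
and the choice of Reed-Solomon codes with Gram matrices of small rank.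

For the first (`exists_hasParamsOf`), the Hermitian dual of an `F`-linear code is its dual for an
alternating form over the subfield with `q` elements, namely the form that governs commutators of
Weyl operators. Take maximal isotropic `L ≤ C` and `L' ≤ C'`, where `C'` is the dual of `C`, and a
common unit eigenvector `w` of their Weyl operators. Translating `w` by representatives of `C / L`
and of `C' / L'` gives the encoding vectors; the first quotient is indexed by the entangled pairs,
the second by the logical states. Summing over the first index makes an error `v` act as zero for `v
∉ C'`, as a scalar for `v ∈ C ⊓ C'`, and not as a scalar for `v ∈ C'` outside `C`
(`WeylSystem.exists_encoding`). Weyl operators supported on `T` span all operators on `T`, so the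
distance is the least weight in `C'` outside the hull.

For the second, the dual of a Reed-Solomon code is again one, hence MDS, and its words of least
weight span it. So the distance is `k + 1` for a code of dimension `k`, unless its dual lies in the
hull, and optimality is automatic: only the hull dimension remains. With multipliers satisfying `a x
^ (q + 1) = h x`, the Hermitian form on polynomials has as entries the moments `∑ h x * x ^ (i + q *
j)`. Four choices of a point set and of `h` leave exactly one nonzero moment for `i, j < k`, on the
diagonal. Puncturing at `s` points raises the rank of the form from `1` to `s + 1`; shortening there
keeps rank `1` and lowers the dimension by `s`. These two codes and their duals give four families
for each choice (`existsOptimalEAQECC_of_moments`). -/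

theorem Module.End.exists_common_eigenvector {V I : Type*} [AddCommGroup V] [Module ℂ V]
    [FiniteDimensional ℂ V] [Nontrivial V] (f : I → Module.End ℂ V)
    (hf : ∀ i j, Commute (f i) (f j)) : ∃ w : V, w ≠ 0 ∧ ∀ i, ∃ t : ℂ, f i w = t • w := by
  -- On a minimal nonzero invariant subspace every `f i` is a scalar: its eigenspace there is
  -- invariant under the commuting family, hence everything.
  obtain ⟨W, ⟨hW0, hWf⟩, hmin⟩ := IsArtinian.set_has_minimal
    {W : Submodule ℂ V | W ≠ ⊥ ∧ ∀ i, ∀ x ∈ W, f i x ∈ W} ⟨⊤, top_ne_bot, by simp⟩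
  have heig : ∀ i, ∃ t : ℂ, ∀ x ∈ W, f i x = t • x := by
    intro i
    have : Nontrivial W := Submodule.nontrivial_iff_ne_bot.2 hW0
    obtain ⟨t, ht⟩ := Module.End.exists_eigenvalue ((f i).restrict (hWf i))
    obtain ⟨⟨w, hwW⟩, hw⟩ := ht.exists_hasEigenvector
    have hw1 : f i w = t • w := congrArg Subtype.val hw.apply_eq_smul
    have hw0 : w ≠ 0 := fun h => hw.2 (Subtype.ext h)
    refine ⟨t, ?_⟩
    by_contra! hcon
    obtain ⟨x, hx, hxt⟩ := hcon
    refine hmin (W ⊓ (f i).eigenspace t) ⟨?_, ?_⟩ ?_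
    · exact (Submodule.ne_bot_iff _).2 ⟨w, ⟨hwW, Module.End.mem_eigenspace_iff.2 hw1⟩, hw0⟩
    · rintro j y ⟨hyW, hy⟩
      refine ⟨hWf j y hyW, Module.End.mem_eigenspace_iff.2 ?_⟩
      have h := LinearMap.congr_fun (hf i j).eq y
      simp only [Module.End.mul_apply] at h
      rw [h, Module.End.mem_eigenspace_iff.1 hy, map_smul]
    · exact lt_of_le_of_ne inf_le_left fun h =>
        hxt (Module.End.mem_eigenspace_iff.1 ((h.ge hx).2))
  obtain ⟨w, hw, hw0⟩ := (Submodule.ne_bot_iff _).1 hW0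
  exact ⟨w, hw0, fun i => (heig i).imp fun t ht => ht w hw⟩

/-- A projective representation of the group `G` by unitary operators whose commutators are given
by an alternating form on `G`. -/
structure WeylSystem (K G ι : Type*) [Field K] [AddCommGroup G] [Module K G] [Fintype ι] where
  ψ : AddChar K ℂ
  primitive : ψ.IsPrimitive
  B : LinearMap.BilinForm K G
  alt : B.IsAlt
  D : G → Module.End ℂ (ι → ℂ)
  isometry : ∀ v f g, star (D v f) ⬝ᵥ D v g = star f ⬝ᵥ g
  mul : ∀ u v, ∃ μ : ℂ, μ ≠ 0 ∧ D u * D v = μ • D (u + v)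
  comm : ∀ u v, D u * D v = ψ (B u v) • (D v * D u)

theorem Submodule.exists_maximal_isotropic {K G : Type*} [Field K] [Finite K] [AddCommGroup G]
    [Module K G] [Finite G] {B : LinearMap.BilinForm K G} (hB : B.IsAlt) (C : Submodule K G) :
    ∃ L ≤ C, (∀ x ∈ L, ∀ y ∈ L, B x y = 0) ∧ ∀ x ∈ C, (∀ l ∈ L, B l x = 0) → x ∈ L := by
  have hfin : {L : Submodule K G | L ≤ C ∧ ∀ x ∈ L, ∀ y ∈ L, B x y = 0}.Finite := Set.toFinite _
  obtain ⟨L, ⟨hLC, hL⟩, hmax⟩ := hfin.exists_maximal ⟨⊥, bot_le, by simp⟩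
  refine ⟨L, hLC, hL, fun x hx hxL => ?_⟩
  refine hmax (y := L ⊔ K ∙ x) ⟨?_, ?_⟩ le_sup_left
    (Submodule.mem_sup_right (Submodule.mem_span_singleton_self x))
  · exact sup_le hLC ((Submodule.span_singleton_le_iff_mem _ _).2 hx)
  · intro u hu v hv
    obtain ⟨a, ha, b, hb, rfl⟩ := Submodule.mem_sup.1 hu
    obtain ⟨c, hc, d, hd, rfl⟩ := Submodule.mem_sup.1 hv
    obtain ⟨s, rfl⟩ := Submodule.mem_span_singleton.1 hb
    obtain ⟨t, rfl⟩ := Submodule.mem_span_singleton.1 hd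
    have h1 := hxL a ha
    have h2 : B x c = 0 := hB.isRefl _ _ (hxL c hc)
    simp [hL a ha c hc, h1, h2, hB x]

/-- Maximality makes `L` its own orthogonal inside `C`, so it is Lagrangian modulo the radical `C ⊓
B.orthogonal C`. -/
theorem Submodule.finrank_maximal_isotropic {K G : Type*} [Field K] [AddCommGroup G]
    [Module K G] [FiniteDimensional K G] {B : LinearMap.BilinForm K G} (hB : B.IsAlt)
    {C L : Submodule K G} (hLC : L ≤ C) (hL : ∀ x ∈ L, ∀ y ∈ L, B x y = 0)
    (hmax : ∀ x ∈ C, (∀ l ∈ L, B l x = 0) → x ∈ L) :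
    2 * Module.finrank K L = Module.finrank K C + Module.finrank K ↥(C ⊓ B.orthogonal C) := by
  have hR : (B.restrict C).IsRefl := fun x y h => hB.isRefl _ _ h
  have h := LinearMap.BilinForm.finrank_add_finrank_orthogonal hR (L.comap C.subtype)
  have h1 : (B.restrict C).orthogonal (L.comap C.subtype) = L.comap C.subtype := by
    ext ⟨x, hx⟩
    simp only [LinearMap.BilinForm.mem_orthogonal_iff, Submodule.mem_comap]
    constructor
    · intro hxo
      exact hmax x hx fun l hl => hxo ⟨l, hLC hl⟩ hl
    · rintro hxL ⟨y, hy⟩ hyL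
      exact hL y hyL x hxL
  have h2 : L.comap C.subtype ⊓ (B.restrict C).orthogonal ⊤
      = (C ⊓ B.orthogonal C).comap C.subtype := by
    ext ⟨x, hx⟩
    simp only [LinearMap.BilinForm.mem_orthogonal_iff, Submodule.mem_comap, Submodule.mem_inf]
    constructor
    · rintro ⟨-, hxo⟩
      exact ⟨hx, fun y hy => hxo ⟨y, hy⟩ trivial⟩
    · rintro ⟨-, hxo⟩
      exact ⟨hmax x hx fun l hl => hxo l (hLC hl), fun y _ => hxo y y.2⟩
  rw [h1, h2, (Submodule.comapSubtypeEquivOfLe hLC).finrank_eq,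
    (Submodule.comapSubtypeEquivOfLe inf_le_left).finrank_eq] at h
  omega

theorem Submodule.exists_transversal {K G Φ : Type*} [Field K] [Fintype K] [AddCommGroup G]
    [Module K G] [Finite G] [Fintype Φ] {L C : Submodule K G} (hLC : L ≤ C) {m : ℕ}
    (hm : Module.finrank K L + m = Module.finrank K C)
    (hΦ : Fintype.card Φ = Fintype.card K ^ m) :
    ∃ y : Φ → G, (∀ φ, y φ ∈ C) ∧ (∀ φ φ', y φ - y φ' ∈ L → φ = φ') ∧
      ∀ g ∈ C, ∃ φ, g - y φ ∈ L := by
  have : Finite (C ⧸ L.comap C.subtype) := Quotient.finite _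
  have : Fintype (C ⧸ L.comap C.subtype) := Fintype.ofFinite _
  have hcard : Fintype.card Φ = Fintype.card (C ⧸ L.comap C.subtype) := by
    have h := Submodule.finrank_quotient_add_finrank (L.comap C.subtype)
    rw [(Submodule.comapSubtypeEquivOfLe hLC).finrank_eq] at h
    rw [hΦ, Module.card_eq_pow_finrank (K := K) (V := C ⧸ L.comap C.subtype)]
    congr 1
    omega
  let e := Fintype.equivOfCardEq hcard
  have he : ∀ φ, Submodule.Quotient.mk (p := L.comap C.subtype) (e φ).out = e φ := fun φ =>
    Quotient.out_eq' (e φ)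
  refine ⟨fun φ => ((e φ).out : C), fun φ => ((e φ).out : C).2, fun φ φ' h => ?_, fun g hg => ?_⟩
  · apply e.injective
    rw [← he φ, ← he φ', Submodule.Quotient.eq]
    exact h
  · refine ⟨e.symm (Submodule.Quotient.mk ⟨g, hg⟩), ?_⟩
    have := he (e.symm (Submodule.Quotient.mk ⟨g, hg⟩))
    rw [Equiv.apply_symm_apply] at this
    beta_reduce
    rw [Equiv.apply_symm_apply]
    exact (Submodule.Quotient.eq (p := L.comap C.subtype)).1 this.symm

namespace WeylSystem

variable {K G ι : Type*} [Field K] [AddCommGroup G] [Module K G] [Fintype ι]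
  (W : WeylSystem K G ι)

theorem comm_apply (u v : G) (f : ι → ℂ) : W.D u (W.D v f) = W.ψ (W.B u v) • W.D v (W.D u f) :=
  LinearMap.congr_fun (W.comm u v) f

theorem comm_apply_of_eq_zero {u v : G} (h : W.B u v = 0) (f : ι → ℂ) :
    W.D u (W.D v f) = W.D v (W.D u f) := by
  rw [comm_apply, h, AddChar.map_zero_eq_one, one_smul]

theorem mul_apply (u v : G) (f : ι → ℂ) : ∃ μ : ℂ, μ ≠ 0 ∧ W.D u (W.D v f) = μ • W.D (u + v) f :=
  let ⟨μ, hμ, h⟩ := W.mul u v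
  ⟨μ, hμ, LinearMap.congr_fun h f⟩

/-- `L` is closed under scalars, so a nonzero value of the form can be rescaled to one where the
nontrivial character `ψ` differs from `1`. -/
theorem exists_char_ne_one (L : Submodule K G) (x : G) (h : ¬ ∀ l ∈ L, W.B l x = 0) :
    ∃ l ∈ L, W.ψ (W.B l x) ≠ 1 := by
  push Not at h
  obtain ⟨l, hl, hlx⟩ := h
  obtain ⟨t, ht⟩ := AddChar.ne_one_iff.1 (W.primitive hlx)
  refine ⟨t • l, L.smul_mem t hl, ?_⟩
  rwa [map_smul, LinearMap.smul_apply, smul_eq_mul, mul_comm, ← AddChar.mulShift_apply]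

variable {W}

theorem eigenvalue_unit {l : G} {f : ι → ℂ} (hf : star f ⬝ᵥ f = 1) {t : ℂ} (h : W.D l f = t • f) :
    star t * t = 1 := by
  have h1 := W.isometry l f f
  rw [h, hf] at h1
  simpa [hf, mul_comm] using h1

/-- Vectors on which a Weyl operator acts by different scalars are orthogonal, also after
application of another Weyl operator. -/
theorem dotProduct_eq_zero {l : G} {f g : ι → ℂ} {s t : ℂ} (hs : star s * s = 1)
    (hf : W.D l f = s • f) (hg : W.D l g = (s * t) • g) (ht : t ≠ 1) : star f ⬝ᵥ g = 0 := by
  have h := W.isometry l f g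
  rw [hf, hg, star_smul, smul_dotProduct, dotProduct_smul, smul_eq_mul, smul_eq_mul, ← mul_assoc,
    ← mul_assoc, hs, one_mul] at h
  have : (t - 1) * (star f ⬝ᵥ g) = 0 := by rw [sub_mul, h, one_mul, sub_self]
  exact (mul_eq_zero.1 this).resolve_left (sub_ne_zero.2 ht)

/-- Conjugating a Weyl operator by another changes it only by a phase; this is what turns the sum
over the entangled index into a character sum. -/
theorem conj_dotProduct (x v : G) (f g : ι → ℂ) :
    star (W.D x f) ⬝ᵥ W.D v (W.D x g) = W.ψ (W.B v x) * (star f ⬝ᵥ W.D v g) := by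
  rw [comm_apply, dotProduct_smul, W.isometry, smul_eq_mul]

end WeylSystem

/-- The encoding vectors of the stabilizer construction with a space `C` and its dual space `C'`:
errors outside `C'` act as zero, those in `C ⊓ C'` as scalars, and those in `C'` outside `C`
do not act as scalars. -/
theorem WeylSystem.exists_encoding {K G ι Φ E : Type*} [Field K] [Fintype K] [AddCommGroup G]
    [Module K G] [Finite G] [Fintype ι] [Nonempty ι] [Fintype Φ] [Fintype E] [DecidableEq Φ]
    [DecidableEq E] (W : WeylSystem K G ι) (C C' : Submodule K G)
    (hC' : ∀ v, v ∈ C' ↔ ∀ u ∈ C, W.B u v = 0) (hC : ∀ v, v ∈ C ↔ ∀ u ∈ C', W.B u v = 0)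
    {c κ : ℕ} (hE : Fintype.card E = Fintype.card K ^ c) (hΦ : Fintype.card Φ = Fintype.card K ^ κ)
    (hc : Module.finrank K ↥(C ⊓ C') + 2 * c = Module.finrank K C)
    (hκ : Module.finrank K ↥(C ⊓ C') + 2 * κ = Module.finrank K C') :
    ∃ V : Φ → E → ι → ℂ,
      (∀ φ e φ' e', star (V φ e) ⬝ᵥ V φ' e' = if φ = φ' ∧ e = e' then 1 else 0) ∧
      (∀ v, v ∉ C' ∨ v ∈ C → ∃ z : ℂ, ∀ φ φ',
        ∑ e, star (V φ e) ⬝ᵥ W.D v (V φ' e) = if φ = φ' then z else 0) ∧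
      ∀ v ∈ C', v ∉ C → ¬ ∃ z : ℂ, ∀ φ φ',
        ∑ e, star (V φ e) ⬝ᵥ W.D v (V φ' e) = if φ = φ' then z else 0 := by
  classical
  have hskew : ∀ {u v}, W.B u v = 0 → W.B v u = 0 := fun {u v} h => W.alt.isRefl u v h
  have hCC' : ∀ u ∈ C, ∀ v ∈ C', W.B u v = 0 := fun u hu v hv => (hC' v).1 hv u hu
  have hC'C : ∀ u ∈ C', ∀ v ∈ C, W.B u v = 0 := fun u hu v hv => (hC v).1 hv u hu
  obtain ⟨L, hLC, hL, hLmax⟩ := C.exists_maximal_isotropic W.alt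
  obtain ⟨L', hLC', hL', hLmax'⟩ := C'.exists_maximal_isotropic W.alt
  have ho : W.B.orthogonal C = C' := by
    ext v
    rw [LinearMap.BilinForm.mem_orthogonal_iff, hC']
  have ho' : W.B.orthogonal C' = C := by
    ext v
    rw [LinearMap.BilinForm.mem_orthogonal_iff, hC]
  have hd := Submodule.finrank_maximal_isotropic W.alt hLC hL hLmax
  have hd' := Submodule.finrank_maximal_isotropic W.alt hLC' hL' hLmax'
  rw [ho] at hd
  rw [ho', inf_comm] at hd'
  obtain ⟨x, hxC, hxL, hx⟩ := Submodule.exists_transversal (Φ := E) hLC (m := c) (by omega) hE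
  obtain ⟨y, hyC, hyL, hy⟩ := Submodule.exists_transversal (Φ := Φ) hLC' (m := κ) (by omega) hΦ
  -- the common eigenvector
  have hLL : ∀ u v : {l // l ∈ L ∨ l ∈ L'}, Commute (W.D u) (W.D v) := by
    rintro ⟨u, hu⟩ ⟨v, hv⟩
    have h : W.B u v = 0 := by
      rcases hu with hu | hu <;> rcases hv with hv | hv
      · exact hL u hu v hv
      · exact hCC' u (hLC hu) v (hLC' hv)
      · exact hC'C u (hLC' hu) v (hLC hv)
      · exact hL' u hu v hv
    change W.D u * W.D v = W.D v * W.D u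
    rw [W.comm, h, AddChar.map_zero_eq_one, one_smul]
  obtain ⟨w₀, hw₀, hw₀L⟩ := Module.End.exists_common_eigenvector _ hLL
  obtain ⟨w, hw1, hwL⟩ : ∃ w : ι → ℂ, star w ⬝ᵥ w = 1 ∧
      ∀ l, l ∈ L ∨ l ∈ L' → ∃ t : ℂ, W.D l w = t • w := by
    have h0 : star w₀ ⬝ᵥ w₀ = ((∑ i, ‖w₀ i‖ ^ 2 : ℝ) : ℂ) := by
      simp [dotProduct, Complex.conj_mul']
    have hpos : 0 < ∑ i, ‖w₀ i‖ ^ 2 := by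
      obtain ⟨i, hi⟩ := Function.ne_iff.1 hw₀
      exact Finset.sum_pos' (fun i _ => by positivity)
        ⟨i, Finset.mem_univ i, by have := norm_pos_iff.2 hi; positivity⟩
    set S := ∑ i, ‖w₀ i‖ ^ 2
    refine ⟨(((Real.sqrt S)⁻¹ : ℝ) : ℂ) • w₀, ?_, fun l hl => ?_⟩
    · rw [star_smul, smul_dotProduct, dotProduct_smul, h0, Complex.star_def, Complex.conj_ofReal]
      simp only [smul_eq_mul, ← Complex.ofReal_mul]
      have := Real.mul_self_sqrt hpos.le
      have h2 : Real.sqrt S ≠ 0 := (Real.sqrt_pos.2 hpos).ne'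
      rw [← Complex.ofReal_one]
      congr 1
      field_simp
      rw [sq, this]
    · obtain ⟨t, ht⟩ := hw₀L ⟨l, hl⟩
      exact ⟨t, by rw [map_smul, ht, smul_comm]⟩
  -- the vectors
  have key : ∀ v φ φ', ∑ e, star (W.D (x e) (W.D (y φ) w)) ⬝ᵥ W.D v (W.D (x e) (W.D (y φ') w)) =
      (∑ e, W.ψ (W.B v (x e))) * (star (W.D (y φ) w) ⬝ᵥ W.D v (W.D (y φ') w)) := by
    intro v φ φ'
    rw [Finset.sum_mul]
    exact Finset.sum_congr rfl fun e _ => W.conj_dotProduct _ _ _ _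
  have eigL : ∀ l ∈ L, ∃ s : ℂ, star s * s = 1 ∧ W.D l w = s • w := fun l hl =>
    (hwL l (.inl hl)).imp fun s hs => ⟨W.eigenvalue_unit hw1 hs, hs⟩
  have eigL' : ∀ l ∈ L', ∃ s : ℂ, star s * s = 1 ∧ W.D l w = s • w := fun l hl =>
    (hwL l (.inr hl)).imp fun s hs => ⟨W.eigenvalue_unit hw1 hs, hs⟩
  have eigy' : ∀ l φ (s : ℂ), W.D l w = s • w →
      W.D l (W.D (y φ) w) = (s * W.ψ (W.B l (y φ))) • W.D (y φ) w := by
    intro l φ s hs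
    rw [W.comm_apply, hs, map_smul, smul_smul, mul_comm]
  -- Distinct cosets of `L'` are separated by some `l ∈ L'`: otherwise the difference of the
  -- representatives would be orthogonal to `L'` and so lie in it by maximality.
  have uorth : ∀ φ φ', star (W.D (y φ) w) ⬝ᵥ W.D (y φ') w = if φ = φ' then 1 else 0 := by
    intro φ φ'
    split_ifs with h
    · rw [h, W.isometry, hw1]
    · obtain ⟨l, hl, hlne⟩ := W.exists_char_ne_one L' (y φ' - y φ) fun hcon =>
        h (hyL _ _ (hLmax' _ (C'.sub_mem (hyC _) (hyC _)) hcon)).symm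
      obtain ⟨s, hs1, hs⟩ := eigL' l hl
      have hs2 : star (s * W.ψ (W.B l (y φ))) * (s * W.ψ (W.B l (y φ))) = 1 :=
        W.eigenvalue_unit (by rw [W.isometry, hw1]) (eigy' l φ s hs)
      refine W.dotProduct_eq_zero hs2 (eigy' l φ s hs) ?_ hlne
      rw [eigy' l φ' s hs, mul_assoc, ← AddChar.map_add_eq_mul, ← map_add, add_sub_cancel]
  have hcoset : ∀ v g h : G, W.B v (g - h) = 0 → W.ψ (W.B v g) = W.ψ (W.B v h) := by
    intro v g h hgh
    rw [map_sub, sub_eq_zero] at hgh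
    rw [hgh]
  refine ⟨fun φ e => W.D (x e) (W.D (y φ) w), ?_, ?_, ?_⟩
  · intro φ e φ' e'
    by_cases he : e = e'
    · subst he
      simp only [W.isometry, uorth, and_true]
    · rw [if_neg fun h => he h.2]
      obtain ⟨l, hl, hlne⟩ := W.exists_char_ne_one L (x e' - x e) fun hcon =>
        he (hxL _ _ (hLmax _ (C.sub_mem (hxC _) (hxC _)) hcon)).symm
      obtain ⟨s, hs1, hs⟩ := eigL l hl
      have hz : ∀ φ e, W.D l (W.D (x e) (W.D (y φ) w)) =
          (s * W.ψ (W.B l (x e))) • W.D (x e) (W.D (y φ) w) := by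
        intro φ e
        rw [W.comm_apply, W.comm_apply_of_eq_zero (hCC' l (hLC hl) _ (hyC φ)), hs, map_smul,
          map_smul, smul_smul, mul_comm]
      have hs2 : star (s * W.ψ (W.B l (x e))) * (s * W.ψ (W.B l (x e))) = 1 :=
        W.eigenvalue_unit (by rw [W.isometry, W.isometry, hw1]) (hz φ e)
      refine W.dotProduct_eq_zero hs2 (hz φ e) ?_ hlne
      rw [hz φ' e', mul_assoc, ← AddChar.map_add_eq_mul, ← map_add, add_sub_cancel]
  · rintro v hv
    by_cases hvC' : v ∈ C'
    · have hvC : v ∈ C := hv.resolve_left (not_not.2 hvC')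
      obtain ⟨s, hs1, hs⟩ := eigL v (hLmax v hvC fun l hl => hCC' l (hLC hl) v hvC')
      refine ⟨(∑ e, W.ψ (W.B v (x e))) * s, fun φ φ' => ?_⟩
      rw [key, eigy' v φ' s hs, hCC' v hvC _ (hyC φ'), AddChar.map_zero_eq_one, mul_one,
        dotProduct_smul, uorth, smul_eq_mul]
      split_ifs <;> simp
    · refine ⟨0, fun φ φ' => ?_⟩
      rw [key, ite_self]
      -- If `v` is orthogonal to `L`, the sum over `e` runs a nontrivial character over `C / L` and
      -- vanishes. If not, some `l ∈ L` has different eigenvalues on the two vectors, and the inner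
      -- product vanishes.
      by_cases hvL : ∀ l ∈ L, W.B l v = 0
      · obtain ⟨u, hu, hune⟩ := W.exists_char_ne_one C v fun h => hvC' ((hC' v).2 h)
        have hune' : W.ψ (W.B v u) ≠ 1 := by
          intro h
          apply hune
          rw [← LinearMap.BilinForm.IsAlt.neg_eq W.alt v u, AddChar.map_neg_eq_inv, h, inv_one]
        -- Translation by `u` permutes the cosets of `L` in `C`; the character sum is therefore
        -- multiplied by a factor other than `1`.
        choose g hg using fun e => hx (x e + u) (C.add_mem (hxC e) hu)
        have hginj : Function.Injective g := by
          intro e e' hee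
          apply hxL
          have := L.sub_mem (hg e) (hg e')
          rw [hee] at this
          simpa using this
        have hgbij := Finite.injective_iff_bijective.1 hginj
        have hsum : ∑ e, W.ψ (W.B v (x e)) = (∑ e, W.ψ (W.B v (x e))) * W.ψ (W.B v u) := by
          rw [Finset.sum_mul, ← hgbij.sum_comp]
          refine Finset.sum_congr rfl fun e _ => ?_
          rw [← AddChar.map_add_eq_mul, ← map_add]
          exact (hcoset v _ _ (hskew (hvL _ (hg e)))).symm
        have : (∑ e, W.ψ (W.B v (x e))) * (W.ψ (W.B v u) - 1) = 0 := by
          rw [mul_sub, ← hsum, mul_one, sub_self]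
        rw [(mul_eq_zero.1 this).resolve_right (sub_ne_zero.2 hune'), zero_mul]
      · obtain ⟨l, hl, hlne⟩ := W.exists_char_ne_one L v hvL
        obtain ⟨s, hs1, hs⟩ := eigL l hl
        have hz : ∀ φ, W.D l (W.D (y φ) w) = s • W.D (y φ) w := by
          intro φ
          rw [W.comm_apply_of_eq_zero (hCC' l (hLC hl) _ (hyC φ)), hs, map_smul]
        rw [W.dotProduct_eq_zero hs1 (hz φ) (t := W.ψ (W.B l v)) ?_ hlne, mul_zero]
        rw [W.comm_apply, hz, map_smul, smul_smul, mul_comm]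
  · rintro v hvC' hvC ⟨z, hz⟩
    have hcard : (∑ e, W.ψ (W.B v (x e))) ≠ 0 := by
      have : ∀ e, W.ψ (W.B v (x e)) = 1 := fun e => by
        rw [hC'C v hvC' _ (hxC e), AddChar.map_zero_eq_one]
      simp only [this, Finset.sum_const, Finset.card_univ, nsmul_eq_mul, mul_one, hE]
      exact_mod_cast pow_ne_zero _ Fintype.card_ne_zero
    simp only [key] at hz
    obtain ⟨φ₀, hφ₀⟩ := hy 0 C'.zero_mem
    -- For `v ∈ L'` the action is diagonal but not constant, since `v` is not orthogonal to `C'`.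
    -- For `v ∉ L'` it moves the coset of `y φ₀` to another one and has a nonzero off-diagonal
    -- entry.
    by_cases hvL : v ∈ L'
    · obtain ⟨u, hu, hune⟩ := W.exists_char_ne_one C' v fun h => hvC ((hC v).2 h)
      have hune' : W.ψ (W.B v u) ≠ 1 := by
        intro h
        apply hune
        rw [← LinearMap.BilinForm.IsAlt.neg_eq W.alt v u, AddChar.map_neg_eq_inv, h, inv_one]
      obtain ⟨φ, hφ⟩ := hy u hu
      obtain ⟨s, hs1, hs⟩ := eigL' v hvL
      have hs0 : s ≠ 0 := right_ne_zero_of_mul_eq_one hs1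
      have hval : ∀ φ, (∑ e, W.ψ (W.B v (x e))) * (s * W.ψ (W.B v (y φ))) = z := by
        intro φ
        have := hz φ φ
        rwa [eigy' v φ s hs, dotProduct_smul, uorth, if_pos rfl, if_pos rfl, smul_eq_mul,
          mul_one] at this
      have h := mul_left_cancel₀ hs0 (mul_left_cancel₀ hcard ((hval φ).trans (hval φ₀).symm))
      rw [← hcoset v _ _ (hL' v hvL _ hφ), ← hcoset v _ _ (hL' v hvL _ hφ₀), map_zero,
        AddChar.map_zero_eq_one] at h
      exact hune' h
    · obtain ⟨φ, hφ⟩ := hy (v + y φ₀) (C'.add_mem hvC' (hyC _))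
      have hne : φ ≠ φ₀ := by
        rintro rfl
        exact hvL (by simpa using hφ)
      have h := hz φ φ₀
      rw [if_neg hne] at h
      obtain ⟨μ₁, hμ₁, h₁⟩ := W.mul_apply v (y φ₀) w
      obtain ⟨μ₂, hμ₂, h₂⟩ := W.mul_apply (y φ) (v + y φ₀ - y φ) w
      obtain ⟨s, hs1, hs⟩ := eigL' _ hφ
      have hs0 : s ≠ 0 := right_ne_zero_of_mul_eq_one hs1
      rw [add_sub_cancel, hs, map_smul] at h₂
      have h₃ : W.D (v + y φ₀) w = (μ₂⁻¹ * s) • W.D (y φ) w := by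
        rw [mul_smul, h₂, smul_smul, inv_mul_cancel₀ hμ₂, one_smul]
      rw [h₁, h₃, smul_smul, dotProduct_smul, uorth, if_pos rfl, smul_eq_mul, mul_one] at h
      exact mul_ne_zero hcard (mul_ne_zero hμ₁ (mul_ne_zero (inv_ne_zero hμ₂) hs0)) h

/-! ### Weyl operators of several qudits -/

theorem AddChar.sum_dotProduct_eq_ite {K I : Type*} [Field K] [Fintype K] [DecidableEq K]
    [Fintype I] [DecidableEq I] {ψ : AddChar K ℂ} (hψ : ψ.IsPrimitive) (y : I → K) :
    ∑ b : I → K, ψ (b ⬝ᵥ y) = if y = 0 then (Fintype.card K : ℂ) ^ Fintype.card I else 0 := by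
  split_ifs with hy
  · simp [hy]
  · let χ : AddChar (I → K) ℂ :=
      ψ.compAddMonoidHom ⟨⟨fun b => b ⬝ᵥ y, zero_dotProduct y⟩, fun b b' => add_dotProduct b b' y⟩
    change ∑ b, χ b = 0
    apply AddChar.sum_eq_zero_of_ne_one
    obtain ⟨i, hi⟩ := Function.ne_iff.1 hy
    obtain ⟨t, ht⟩ := AddChar.ne_one_iff.1 (hψ hi)
    refine AddChar.ne_one_iff.2 ⟨Pi.single i t, ?_⟩
    change ψ (Pi.single i t ⬝ᵥ y) ≠ 1
    rwa [single_dotProduct, mul_comm, ← AddChar.mulShift_apply]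

section Weyl

/-- The labelling of the computational basis by vectors over `K`. -/
def labelling {q : ℕ} {K : Type*} (n : ℕ) (σ : Fin q ≃ K) : (Fin n → Fin q) ≃ (Fin n → K) :=
  Equiv.piCongrRight fun _ => σ

theorem labelling_apply {q n : ℕ} {K : Type*} (σ : Fin q ≃ K) (x : Fin n → Fin q) (i : Fin n) :
    labelling n σ x i = σ (x i) := rfl

theorem labelling_symm_apply {q n : ℕ} {K : Type*} (σ : Fin q ≃ K) (x : Fin n → K) (i : Fin n) :
    (labelling n σ).symm x i = σ.symm (x i) := rfl

variable {q n : ℕ} {K F : Type*} [Field K] [Field F] [Algebra K F]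

/-- The coordinate vector `j` of `v`. -/
def coordVec (ε : F ≃ₗ[K] (Fin 2 → K)) (j : Fin 2) : (Fin n → F) →ₗ[K] (Fin n → K) :=
  LinearMap.pi fun i => LinearMap.proj j ∘ₗ ε.toLinearMap ∘ₗ LinearMap.proj i

theorem coordVec_apply (ε : F ≃ₗ[K] (Fin 2 → K)) (j : Fin 2) (v : Fin n → F) (i : Fin n) :
    coordVec ε j v i = ε (v i) j := rfl

/-- The Weyl operator of `v`: a shift by the coordinates `0` after a modulation by the
coordinates `1`. -/
noncomputable def weylOp (σ : Fin q ≃ K) (ψ : AddChar K ℂ) (ε : F ≃ₗ[K] (Fin 2 → K))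
    (v : Fin n → F) : Module.End ℂ ((Fin n → Fin q) → ℂ) where
  toFun f x := ψ (coordVec ε 1 v ⬝ᵥ (labelling n σ x - coordVec ε 0 v)) *
    f ((labelling n σ).symm (labelling n σ x - coordVec ε 0 v))
  map_add' f g := by ext x; simp [mul_add]
  map_smul' t f := by ext x; simp [mul_left_comm]

theorem weylOp_apply (σ : Fin q ≃ K) (ψ : AddChar K ℂ) (ε : F ≃ₗ[K] (Fin 2 → K))
    (v : Fin n → F) (f : (Fin n → Fin q) → ℂ) (x : Fin n → Fin q) :
    weylOp σ ψ ε v f x = ψ (coordVec ε 1 v ⬝ᵥ (labelling n σ x - coordVec ε 0 v)) *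
      f ((labelling n σ).symm (labelling n σ x - coordVec ε 0 v)) := rfl

/-- The alternating form of the commutators of the Weyl operators. -/
def weylForm (n : ℕ) (ε : F ≃ₗ[K] (Fin 2 → K)) : LinearMap.BilinForm K (Fin n → F) :=
  (dotProductBilin K K).compl₁₂ (coordVec ε 1) (coordVec ε 0) -
    (dotProductBilin K K).compl₁₂ (coordVec ε 0) (coordVec ε 1)

theorem weylForm_apply (ε : F ≃ₗ[K] (Fin 2 → K)) (u v : Fin n → F) :
    weylForm n ε u v = coordVec ε 1 u ⬝ᵥ coordVec ε 0 v - coordVec ε 0 u ⬝ᵥ coordVec ε 1 v := rfl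

/-- The Weyl operators of `n` qudits. -/
noncomputable def qudits [Fintype K] (n : ℕ) (σ : Fin q ≃ K) {ψ : AddChar K ℂ} (hψ : ψ.IsPrimitive)
    (ε : F ≃ₗ[K] (Fin 2 → K)) : WeylSystem K (Fin n → F) (Fin n → Fin q) where
  ψ := ψ
  primitive := hψ
  B := weylForm n ε
  alt v := by rw [weylForm_apply, dotProduct_comm, sub_self]
  D := weylOp σ ψ ε
  isometry v f g := by
    let s : (Fin n → Fin q) ≃ (Fin n → Fin q) :=
      ((labelling n σ).trans (Equiv.subRight (coordVec ε 0 v))).trans (labelling n σ).symm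
    simp only [dotProduct, ← s.sum_comp fun x => star f x * g x]
    refine Finset.sum_congr rfl fun x _ => ?_
    rw [Pi.star_apply, weylOp_apply, weylOp_apply, star_mul', mul_mul_mul_comm,
      Complex.star_def, Complex.conj_mul', AddChar.norm_apply]
    simp [s]
  mul u v := by
    refine ⟨ψ (coordVec ε 1 u ⬝ᵥ coordVec ε 0 v), ?_, ?_⟩
    · rw [← norm_ne_zero_iff, AddChar.norm_apply]
      exact one_ne_zero
    · refine LinearMap.ext fun f => funext fun x => ?_
      simp only [Module.End.mul_apply, LinearMap.smul_apply, Pi.smul_apply, smul_eq_mul]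
      simp only [weylOp_apply, Equiv.apply_symm_apply, ← mul_assoc, ← AddChar.map_add_eq_mul,
        map_add, sub_sub]
      congr 2
      simp only [add_dotProduct, dotProduct_sub, dotProduct_add]
      ring
  comm u v := by
    refine LinearMap.ext fun f => funext fun x => ?_
    simp only [Module.End.mul_apply, LinearMap.smul_apply, Pi.smul_apply, smul_eq_mul]
    simp only [weylOp_apply, Equiv.apply_symm_apply, ← mul_assoc, ← AddChar.map_add_eq_mul,
      weylForm_apply, sub_sub, add_comm (coordVec ε 0 v)]
    congr 2
    simp only [dotProduct_sub, dotProduct_add, dotProduct_comm (coordVec ε 0 u)]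
    ring

/-- The vector supported on `T` with given coordinates. -/
noncomputable def localVec (ε : F ≃ₗ[K] (Fin 2 → K)) (T : Finset (Fin n)) (a b : T → K) :
    Fin n → F :=
  fun i => if h : i ∈ T then ε.symm ![a ⟨i, h⟩, b ⟨i, h⟩] else 0

theorem localVec_eq_zero (ε : F ≃ₗ[K] (Fin 2 → K)) (T : Finset (Fin n)) (a b : T → K) {i : Fin n}
    (h : i ∉ T) : localVec ε T a b i = 0 := dif_neg h

theorem coordVec_zero_localVec (ε : F ≃ₗ[K] (Fin 2 → K)) (T : Finset (Fin n)) (a b : T → K)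
    (i : Fin n) : coordVec ε 0 (localVec ε T a b) i = if h : i ∈ T then a ⟨i, h⟩ else 0 := by
  rw [coordVec_apply, localVec]
  split_ifs <;> simp

theorem coordVec_one_localVec (ε : F ≃ₗ[K] (Fin 2 → K)) (T : Finset (Fin n)) (a b : T → K)
    (i : Fin n) : coordVec ε 1 (localVec ε T a b) i = if h : i ∈ T then b ⟨i, h⟩ else 0 := by
  rw [coordVec_apply, localVec]
  split_ifs <;> simp

theorem Finset.sum_dite_mul {n : ℕ} {R : Type*} [CommSemiring R] (T : Finset (Fin n)) (b : T → R)
    (x : Fin n → R) : ∑ i, (if h : i ∈ T then b ⟨i, h⟩ else 0) * x i = ∑ i : T, b i * x i := by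
  rw [← Finset.sum_subset (Finset.subset_univ T), ← Finset.sum_attach]
  · exact Finset.sum_congr rfl fun i _ => by rw [dif_pos i.2]
  · intro i _ hi
    rw [dif_neg hi, zero_mul]

theorem localOp_mulVec {T : Finset (Fin n)} (A : Matrix (T → Fin q) (T → Fin q) ℂ)
    (f : (Fin n → Fin q) → ℂ) (x : Fin n → Fin q) :
    (localOp T A).mulVec f x =
      ∑ y : T → Fin q, A (fun i => x i) y * f fun i => if h : i ∈ T then y ⟨i, h⟩ else x i := by
  classical
  simp only [Matrix.mulVec, dotProduct, localOp, ite_mul, zero_mul]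
  rw [← Finset.sum_filter]
  symm
  refine Finset.sum_nbij' (fun y i => if h : i ∈ T then y ⟨i, h⟩ else x i) (fun y i => y i)
    ?_ ?_ ?_ ?_ ?_
  · intro y _
    simp only [Finset.mem_filter, Finset.mem_univ, true_and]
    intro i hi
    rw [dif_neg hi]
  · simp
  · intro y _
    ext i
    simp
  · intro y hy
    simp only [Finset.mem_filter, Finset.mem_univ, true_and] at hy
    funext i
    by_cases h : i ∈ T
    · simp [h]
    · simp [h, hy i h]
  · intro y _
    simp

/-- A local operator is a linear combination of local Weyl operators. -/
theorem localOp_mulVec_eq_sum [Fintype K] {σ : Fin q ≃ K} {ψ : AddChar K ℂ} (hψ : ψ.IsPrimitive)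
    (ε : F ≃ₗ[K] (Fin 2 → K)) {T : Finset (Fin n)} (A : Matrix (T → Fin q) (T → Fin q) ℂ) :
    ∃ c : (T → K) × (T → K) → ℂ, ∀ f : (Fin n → Fin q) → ℂ,
      (localOp T A).mulVec f = ∑ v, c v • weylOp σ ψ ε (localVec ε T v.1 v.2) f := by
  classical
  have hcard : ((Fintype.card K : ℂ) ^ Fintype.card T) ≠ 0 :=
    pow_ne_zero _ (by exact_mod_cast Fintype.card_ne_zero)
  -- The coefficient at `(a, b)` is the Fourier coefficient at `b` of the shifted diagonal `y ↦ A (y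
  -- + a, y)`; summing over `b` inverts the transform.
  refine ⟨fun v => ((Fintype.card K : ℂ) ^ Fintype.card T)⁻¹ * ∑ y : T → Fin q,
    A (fun i => σ.symm (σ (y i) + v.1 i)) y * ψ (-(v.2 ⬝ᵥ fun i => σ (y i))), fun f => ?_⟩
  ext x
  rw [localOp_mulVec, Fintype.sum_prod_type, Finset.sum_apply]
  have hw : ∀ a b : T → K, weylOp σ ψ ε (localVec ε T a b) f x =
      ψ (b ⬝ᵥ fun i : T => σ (x i) - a i) *
        f (fun i => if h : i ∈ T then σ.symm (σ (x i) - a ⟨i, h⟩) else x i) := by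
    intro a b
    rw [weylOp_apply]
    congr 2
    · have : coordVec ε 1 (localVec ε T a b) = fun i => if h : i ∈ T then b ⟨i, h⟩ else 0 :=
        funext (coordVec_one_localVec ε T a b)
      rw [this, dotProduct, Finset.sum_dite_mul]
      refine Finset.sum_congr rfl fun i _ => ?_
      rw [Pi.sub_apply, coordVec_zero_localVec, dif_pos i.2, labelling_apply]
    · ext i
      rw [labelling_symm_apply, Pi.sub_apply, coordVec_zero_localVec, labelling_apply]
      split_ifs <;> simp
  have hsum : ∀ a : T → K, (∑ b : T → K, (((Fintype.card K : ℂ) ^ Fintype.card T)⁻¹ *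
      ∑ y : T → Fin q, A (fun i => σ.symm (σ (y i) + a i)) y * ψ (-(b ⬝ᵥ fun i => σ (y i)))) *
        (ψ (b ⬝ᵥ fun i : T => σ (x i) - a i) *
        f (fun i => if h : i ∈ T then σ.symm (σ (x i) - a ⟨i, h⟩) else x i))) =
      A (fun i => x i) (fun i => σ.symm (σ (x i) - a i)) *
        f (fun i => if h : i ∈ T then σ.symm (σ (x i) - a ⟨i, h⟩) else x i) := by
    intro a
    set g := f (fun i => if h : i ∈ T then σ.symm (σ (x i) - a ⟨i, h⟩) else x i)
    have h1 : ∀ b : T → K, (((Fintype.card K : ℂ) ^ Fintype.card T)⁻¹ *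
        ∑ y : T → Fin q, A (fun i => σ.symm (σ (y i) + a i)) y * ψ (-(b ⬝ᵥ fun i => σ (y i)))) *
        (ψ (b ⬝ᵥ fun i : T => σ (x i) - a i) * g) =
        ∑ y : T → Fin q, (((Fintype.card K : ℂ) ^ Fintype.card T)⁻¹ *
          A (fun i => σ.symm (σ (y i) + a i)) y * g) *
          ψ (b ⬝ᵥ fun i : T => σ (x i) - a i - σ (y i)) := by
      intro b
      rw [Finset.mul_sum, Finset.sum_mul]
      refine Finset.sum_congr rfl fun y _ => ?_
      have : (b ⬝ᵥ fun i : T => σ (x i) - a i - σ (y i)) =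
          -(b ⬝ᵥ fun i => σ (y i)) + (b ⬝ᵥ fun i : T => σ (x i) - a i) := by
        rw [← dotProduct_neg, ← dotProduct_add]
        congr 1
        ext i
        simp only [Pi.add_apply, Pi.neg_apply]
        ring
      rw [this, AddChar.map_add_eq_mul]
      ring
    simp only [h1]
    rw [Finset.sum_comm]
    simp only [← Finset.mul_sum, AddChar.sum_dotProduct_eq_ite hψ]
    rw [Finset.sum_eq_single fun i : T => σ.symm (σ (x i) - a i)]
    · rw [if_pos (by ext i; simp)]
      simp only [Equiv.apply_symm_apply, sub_add_cancel, Equiv.symm_apply_apply]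
      field_simp
    · intro y _ hy
      rw [if_neg, mul_zero]
      intro h
      apply hy
      ext1 i
      have := congrFun h i
      simp only [Pi.zero_apply, sub_eq_zero] at this
      rw [this, Equiv.symm_apply_apply]
    · simp
  simp only [Finset.sum_apply, Pi.smul_apply, smul_eq_mul, hw, hsum]
  let s : (T → K) ≃ (T → Fin q) :=
    (Equiv.subLeft fun i : T => σ (x i)).trans (Equiv.piCongrRight fun _ => σ.symm)
  exact (s.sum_comp _).symm

/-- A Weyl operator acts locally on the support of its label. -/
theorem exists_localOp_eq_weylOp (σ : Fin q ≃ K) (ψ : AddChar K ℂ)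
    (ε : F ≃ₗ[K] (Fin 2 → K)) {T : Finset (Fin n)} {v : Fin n → F} (hv : ∀ i ∉ T, v i = 0) :
    ∃ A : Matrix (T → Fin q) (T → Fin q) ℂ, ∀ f : (Fin n → Fin q) → ℂ,
      (localOp T A).mulVec f = weylOp σ ψ ε v f := by
  classical
  refine ⟨Matrix.of fun x y => if y = fun i : T => σ.symm (σ (x i) - coordVec ε 0 v i) then
    ψ (∑ i : T, coordVec ε 1 v i * (σ (x i) - coordVec ε 0 v i)) else 0, fun f => ?_⟩
  have hv' : ∀ j, ∀ i ∉ T, coordVec ε j v i = 0 := fun j i hi => by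
    rw [coordVec_apply, hv i hi, map_zero, Pi.zero_apply]
  ext x
  rw [localOp_mulVec, weylOp_apply]
  simp only [Matrix.of_apply, ite_mul, zero_mul, Finset.sum_ite_eq', Finset.mem_univ, if_true]
  congr 2
  · rw [Finset.sum_coe_sort T fun i => coordVec ε 1 v i * (σ (x i) - coordVec ε 0 v i)]
    refine Finset.sum_subset (Finset.subset_univ T) fun i _ hi => ?_
    rw [hv' 1 i hi, zero_mul]
  · ext i
    rw [labelling_symm_apply, Pi.sub_apply, labelling_apply]
    split_ifs with h
    · rfl
    · rw [hv' 0 i h, sub_zero, Equiv.symm_apply_apply]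

end Weyl

/-! ### Codes with given encoding vectors -/

namespace EAQECC

variable {q n κ c : ℕ}

theorem encode_apply (Q : EAQECC q n κ c) (x : Fin n → Fin q) (b : Fin c → Fin q)
    (φ : Fin κ → Fin q) :
    Q.encode (x, b) φ = Q.V x (φ, b) * ((Real.sqrt ((q : ℝ) ^ c))⁻¹ : ℝ) := by
  simp [encode, maxEntangled]

/-- The operator is the identity on the receiver's side, so only equal receiver indices `e`
contribute: the maximally entangled state averages over `e`. -/
theorem encode_conj_apply (Q : EAQECC q n κ c)
    (M : Matrix (Fin n → Fin q) (Fin n → Fin q) ℂ) (φ φ' : Fin κ → Fin q) :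
    (Q.encode.conjTranspose * (M ⊗ₖ (1 : Matrix (Fin c → Fin q) (Fin c → Fin q) ℂ)) *
      Q.encode) φ φ' = ((q : ℂ) ^ c)⁻¹ *
        ∑ e, star (fun x => Q.V x (φ, e)) ⬝ᵥ M.mulVec fun x => Q.V x (φ', e) := by
  have hs : ((Real.sqrt ((q : ℝ) ^ c))⁻¹ : ℝ) * ((Real.sqrt ((q : ℝ) ^ c))⁻¹ : ℝ) =
      ((q : ℝ) ^ c)⁻¹ := by
    rw [← mul_inv, Real.mul_self_sqrt (by positivity)]
  have hs' : (((Real.sqrt ((q : ℝ) ^ c))⁻¹ : ℝ) : ℂ) * (((Real.sqrt ((q : ℝ) ^ c))⁻¹ : ℝ) : ℂ) =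
      ((q : ℂ) ^ c)⁻¹ := by
    rw [← Complex.ofReal_mul, hs]
    push_cast
    rfl
  generalize hr : (((Real.sqrt ((q : ℝ) ^ c))⁻¹ : ℝ) : ℂ) = r at hs'
  have hr' : star r = r := by rw [← hr, Complex.star_def, Complex.conj_ofReal]
  rw [Matrix.mul_assoc, Matrix.mul_apply, Fintype.sum_prod_type, Finset.sum_comm, Finset.mul_sum]
  refine Finset.sum_congr rfl fun e _ => ?_
  rw [dotProduct, Finset.mul_sum]
  refine Finset.sum_congr rfl fun x _ => ?_
  rw [Matrix.conjTranspose_apply, encode_apply, hr, star_mul', hr', Matrix.mul_apply,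
    Fintype.sum_prod_type, ← hs']
  have : ∀ y, ∑ b, (M ⊗ₖ (1 : Matrix (Fin c → Fin q) (Fin c → Fin q) ℂ)) (x, e) (y, b) *
      Q.encode (y, b) φ' = M x y * Q.V y (φ', e) * r := by
    intro y
    rw [Finset.sum_eq_single e]
    · rw [Matrix.kroneckerMap_apply, Matrix.one_apply_eq, mul_one, encode_apply, hr, mul_assoc]
    · intro b _ hb
      rw [Matrix.kroneckerMap_apply, Matrix.one_apply_ne hb.symm, mul_zero, zero_mul]
    · simp
  simp only [this, ← Finset.sum_mul]
  rw [Pi.star_apply, Matrix.mulVec, dotProduct]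
  ring

end EAQECC

/-! ### The field with `q ^ 2` elements -/

section Field

variable {F : Type*} [Field F] [Fintype F]

theorem Nat.card_pow_eq_one (F : Type*) [Field F] [Fintype F] [DecidableEq F] (d : ℕ) :
    (Finset.univ.filter fun y : F => y ≠ 0 ∧ y ^ d = 1).card = (Fintype.card F - 1).gcd d := by
  have h := IsCyclic.card_powMonoidHom_ker Fˣ d
  rw [Nat.card_eq_fintype_card (α := Fˣ), Fintype.card_units] at h
  rw [← h, ← Fintype.card_subtype, ← Nat.card_eq_fintype_card]
  refine Nat.card_congr ⟨fun y => ⟨Units.mk0 y.1 y.2.1, ?_⟩, fun y => ⟨(y.1 : F), y.1.ne_zero, ?_⟩,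
    fun y => rfl, fun y => by ext; rfl⟩
  · rw [MonoidHom.mem_ker, powMonoidHom_apply]
    ext
    simpa using y.2.2
  · have := y.2
    rw [MonoidHom.mem_ker, powMonoidHom_apply] at this
    simpa using congrArg Units.val this

theorem IsPrimePow.exists_frobenius {q : ℕ} (hq : IsPrimePow q) (hF : Fintype.card F = q ^ 2) :
    ∃ φ : F →+* F, ∀ x, φ x = x ^ q := by
  obtain ⟨p, m, hp, hm, rfl⟩ := hq
  have : Fact p.Prime := ⟨hp.nat_prime⟩
  rw [← pow_mul] at hF
  have : CharP F p := charP_of_card_eq_prime_pow hF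
  exact ⟨iterateFrobenius F p m, fun x => iterateFrobenius_def p m x⟩

theorem pow_pow_eq_self {q : ℕ} (hF : Fintype.card F = q ^ 2) (x : F) : (x ^ q) ^ q = x := by
  rw [← pow_mul, ← sq, ← hF, FiniteField.pow_card]

theorem Nat.sq_sub_one_eq {q : ℕ} (hq : 1 < q) : q ^ 2 - 1 = (q + 1) * (q - 1) := by
  obtain ⟨r, rfl⟩ : ∃ r, q = r + 1 := ⟨q - 1, by omega⟩
  simp only [Nat.add_sub_cancel]
  have : (r + 1) ^ 2 = (r + 1 + 1) * r + 1 := by ring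
  omega

/-- The fixed field of `x ↦ x ^ q` consists of `0` and the roots of `y ^ (q - 1) = 1`, of which a
cyclic group of order `q ^ 2 - 1` contains `q - 1`. -/
theorem IsPrimePow.exists_subfield {q : ℕ} (hq : IsPrimePow q) (hF : Fintype.card F = q ^ 2) :
    ∃ K : Subfield F, (∀ x, x ∈ K ↔ x ^ q = x) ∧ Nat.card K = q := by
  classical
  obtain ⟨φ, hφ⟩ := hq.exists_frobenius hF
  have hmem : ∀ x, x ∈ RingHom.eqLocusField φ (RingHom.id F) ↔ x ^ q = x := fun x => by
    rw [← hφ]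
    rfl
  refine ⟨RingHom.eqLocusField φ (RingHom.id F), hmem, ?_⟩
  have h1 := hq.one_lt
  have hset : (Finset.univ.filter fun y : F => y ∈ RingHom.eqLocusField φ (RingHom.id F)) =
      insert 0 (Finset.univ.filter fun y : F => y ≠ 0 ∧ y ^ (q - 1) = 1) := by
    ext y
    simp only [Finset.mem_filter, Finset.mem_univ, true_and, Finset.mem_insert, hmem]
    by_cases hy : y = 0
    · simp [hy, hq.ne_zero]
    · have : y ^ q = y ^ (q - 1) * y := by rw [← pow_succ, Nat.sub_add_cancel h1.le]
      simp [hy, this]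
  rw [Nat.card_eq_fintype_card, Fintype.card_subtype, hset, Finset.card_insert_of_notMem (by simp),
    Nat.card_pow_eq_one, hF, Nat.sq_sub_one_eq h1, Nat.gcd_mul_left_left]
  omega

end Field

/-! ### The Hermitian construction -/

section Construction

universe u

variable {q n : ℕ} {F : Type u} [Field F]

theorem hermInner_smul_left (a : F) (u v : Fin n → F) :
    hermInner q (a • u) v = a * hermInner q u v := by
  simp [hermInner, Finset.mul_sum, mul_assoc]

theorem mem_hermDual {C : Submodule F (Fin n → F)} {u : Fin n → F} :
    u ∈ hermDual q C ↔ ∀ v ∈ C, hermInner q u v = 0 := Iff.rfl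

theorem mem_hermHull {C : Submodule F (Fin n → F)} {u : Fin n → F} :
    u ∈ hermHull q C ↔ u ∈ C ∧ u ∈ hermDual q C := Iff.rfl

theorem finrank_restrictScalars_of_coordinates {K : Type*} [Field K] [Algebra K F]
    (ε : F ≃ₗ[K] (Fin 2 → K)) (C : Submodule F (Fin n → F)) :
    Module.finrank K (C.restrictScalars K) = 2 * Module.finrank F C := by
  have h := Module.finrank_mul_finrank K F C
  rw [ε.finrank_eq, Module.finrank_fin_fun] at h
  exact h.symm

theorem hermDual_top (hq : IsPrimePow q) {v : Fin n → F}
    (hv : v ∈ hermDual q (⊤ : Submodule F (Fin n → F))) : v = 0 := by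
  classical
  ext i
  have h := hv (Pi.single i 1) trivial
  rw [hermInner, Finset.sum_eq_single i] at h
  · simpa using h
  · intro j _ hj
    rw [Pi.single_eq_of_ne hj, zero_pow hq.ne_zero, mul_zero]
  · simp

variable [Fintype F]

theorem hermInner_pow (hq : IsPrimePow q) (hF : Fintype.card F = q ^ 2) (u v : Fin n → F) :
    hermInner q u v ^ q = hermInner q v u := by
  obtain ⟨φ, hφ⟩ := hq.exists_frobenius hF
  rw [← hφ, hermInner, map_sum]
  refine Finset.sum_congr rfl fun i _ => ?_
  rw [hφ, mul_pow, pow_pow_eq_self hF, mul_comm]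

/-- Coordinates over the subfield with `q` elements for which the symplectic dual of a linear code
is the Hermitian dual. -/
theorem IsPrimePow.exists_coordinates (hq : IsPrimePow q) (hF : Fintype.card F = q ^ 2) :
    ∃ (K : Type u) (_ : Field K) (_ : Fintype K) (_ : Algebra K F) (ε : F ≃ₗ[K] (Fin 2 → K)),
      Fintype.card K = q ∧ ∀ n, ∀ C : Submodule F (Fin n → F), ∀ v,
        v ∈ hermDual q C ↔ ∀ u ∈ C, weylForm n ε u v = 0 := by
  classical
  obtain ⟨K, hK, hcard⟩ := hq.exists_subfield hF
  have hq1 := hq.one_lt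
  have hrank : Module.finrank K F = 2 := by
    have h := Module.card_eq_pow_finrank (K := K) (V := F)
    rw [hF, ← Nat.card_eq_fintype_card (α := K), hcard] at h
    exact (Nat.pow_right_injective hq1 h).symm
  let b := Module.finBasisOfFinrankEq K F hrank
  have hpow : ∀ a : K, (a : F) ^ q = a := fun a => (hK _).1 a.2
  -- If this vanished, `b 1 / b 0` would be fixed by Frobenius, making the basis dependent over `K`.
  have hθ : b 0 * b 1 ^ q - b 0 ^ q * b 1 ≠ 0 := by
    intro h
    have h0 : b 0 ≠ 0 := b.ne_zero 0
    have h1 : b 1 / b 0 ∈ K := by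
      rw [hK, div_pow, div_eq_div_iff (pow_ne_zero _ h0) h0, mul_comm, sub_eq_zero.1 h, mul_comm]
    have hli : LinearIndependent K ![b 0, b 1] := by
      have : (b : Fin 2 → F) = ![b 0, b 1] := by ext i; fin_cases i <;> rfl
      exact this ▸ b.linearIndependent
    have hli := LinearIndependent.pair_iff.1 hli ⟨b 1 / b 0, h1⟩ (-1) (by
          rw [Subfield.smul_def, smul_eq_mul, div_mul_cancel₀ _ h0, neg_smul, one_smul,
            add_neg_cancel])
    exact one_ne_zero (neg_eq_zero.1 hli.2)
  have hform : ∀ n, ∀ u v : Fin n → F, hermInner q u v - hermInner q v u =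
      -((b 0 * b 1 ^ q - b 0 ^ q * b 1) * (weylForm n b.equivFun u v : K)) := by
    obtain ⟨φ, hφ⟩ := hq.exists_frobenius hF
    intro n u v
    have hdec : ∀ x : F, x = b.equivFun x 0 * b 0 + b.equivFun x 1 * b 1 := by
      intro x
      have := b.sum_equivFun x
      rw [Fin.sum_univ_two, Subfield.smul_def, Subfield.smul_def] at this
      exact this.symm
    have hdecq : ∀ x : F, x ^ q = b.equivFun x 0 * b 0 ^ q + b.equivFun x 1 * b 1 ^ q := by
      intro x
      conv_lhs => rw [hdec x]
      rw [← hφ, map_add, map_mul, map_mul, hφ, hφ, hφ, hφ, hpow, hpow]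
    rw [weylForm_apply, hermInner, hermInner, ← Finset.sum_sub_distrib, dotProduct, dotProduct,
      ← Finset.sum_sub_distrib, AddSubmonoidClass.coe_finsetSum, Finset.mul_sum,
      ← Finset.sum_neg_distrib]
    refine Finset.sum_congr rfl fun i _ => ?_
    rw [hdecq (u i), hdecq (v i),
      show u i * _ - v i * _ = (b.equivFun (u i) 0 * b 0 + b.equivFun (u i) 1 * b 1) *
        (b.equivFun (v i) 0 * b 0 ^ q + b.equivFun (v i) 1 * b 1 ^ q) -
        (b.equivFun (v i) 0 * b 0 + b.equivFun (v i) 1 * b 1) *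
        (b.equivFun (u i) 0 * b 0 ^ q + b.equivFun (u i) 1 * b 1 ^ q) by rw [← hdec, ← hdec]]
    simp only [coordVec_apply, AddSubgroupClass.coe_sub, MulMemClass.coe_mul]
    ring
  -- The alternating form only detects whether the Hermitian product is symmetric in `u` and `v`.
  -- Testing also against `t • u` with `t` outside `K` forces the product itself to vanish.
  obtain ⟨t, ht⟩ : ∃ t : F, t ^ q ≠ t := by
    by_contra! hcon
    have : K = ⊤ := by
      ext x
      simp [hK, hcon]
    rw [this, Nat.card_congr (Subfield.topEquiv (K := F)).toEquiv, Nat.card_eq_fintype_card, hF] at hcard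
    nlinarith
  refine ⟨K, inferInstance, inferInstance, inferInstance, b.equivFun,
    by rw [← Nat.card_eq_fintype_card, hcard], fun n C v => ?_⟩
  have hiff : ∀ u, weylForm n b.equivFun u v = 0 ↔ hermInner q u v = hermInner q v u := by
    intro u
    rw [← sub_eq_zero (a := hermInner q u v), hform, neg_eq_zero, mul_eq_zero, or_iff_right hθ,
      ZeroMemClass.coe_eq_zero]
  rw [mem_hermDual]
  simp only [hiff]
  constructor
  · intro h u hu
    rw [h u hu, ← hermInner_pow hq hF, h u hu, zero_pow hq.ne_zero]
  · intro h u hu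
    have h1 := h u hu
    have h2 := h (t • u) (C.smul_mem t hu)
    rw [← hermInner_pow hq hF (t • u), hermInner_smul_left, mul_pow, hermInner_pow hq hF, ← h1]
      at h2
    have h3 : (t ^ q - t) * hermInner q u v = 0 := by rw [sub_mul, h2, sub_self]
    rw [← h1]
    exact (mul_eq_zero.1 h3).resolve_left (sub_ne_zero.2 ht)

/-- Both facts are those of a nondegenerate alternating form over `K`, where every dimension is
twice the one over `F`. -/
theorem hermDual_spec (hq : IsPrimePow q) (hF : Fintype.card F = q ^ 2)
    (C : Submodule F (Fin n → F)) :
    hermDual q (hermDual q C) = C ∧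
      Module.finrank F (hermDual q C) + Module.finrank F C = n := by
  obtain ⟨K, _, _, _, ε, hcard, hε⟩ := hq.exists_coordinates hF
  have : Module.Finite K F := Module.Finite.equiv ε.symm
  have : Module.Finite K (Fin n → F) := Module.Finite.pi
  have halt : (weylForm n ε).IsAlt := fun v => by
    rw [weylForm_apply, dotProduct_comm, sub_self]
  have hnd : (weylForm n ε).Nondegenerate := by
    refine (LinearMap.IsRefl.nondegenerate_iff_separatingLeft halt.isRefl).2 fun v hv => ?_
    exact hermDual_top hq ((hε n ⊤ v).2 fun u _ => halt.isRefl _ _ (hv u))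
  have hdual : ∀ D : Submodule F (Fin n → F), (weylForm n ε).orthogonal (D.restrictScalars K) =
      (hermDual q D).restrictScalars K := by
    intro D
    ext v
    rw [LinearMap.BilinForm.mem_orthogonal_iff, Submodule.restrictScalars_mem, hε]
    rfl
  constructor
  · have h := LinearMap.BilinForm.orthogonal_orthogonal hnd halt.isRefl (C.restrictScalars K)
    rw [hdual, hdual] at h
    exact Submodule.restrictScalars_injective K _ _ h
  · have h := LinearMap.BilinForm.finrank_add_finrank_orthogonal' (B := weylForm n ε)
      (C.restrictScalars K)
    have htop := finrank_restrictScalars_of_coordinates ε (⊤ : Submodule F (Fin n → F))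
    rw [finrank_top, Module.finrank_fin_fun] at htop
    have htop' : Module.finrank K (Fin n → F) = 2 * n := by
      rw [← htop]
      exact (finrank_top K (Fin n → F)).symm
    rw [hnd.ker_eq_bot, inf_bot_eq, finrank_bot, hdual,
      finrank_restrictScalars_of_coordinates ε, finrank_restrictScalars_of_coordinates ε,
      htop'] at h
    omega

/-- The Hermitian construction of entanglement-assisted codes. -/
theorem exists_hasParamsOf (hq : IsPrimePow q) (hF : Fintype.card F = q ^ 2) {κ c δ : ℕ}
    (C : Submodule F (Fin n → F))
    (hc : Module.finrank F C = Module.finrank F (hermHull q C) + c)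
    (hκ : n = Module.finrank F C + Module.finrank F (hermHull q C) + κ)
    (hδ : IsLeast (weightSet ((hermDual q C : Set (Fin n → F)) \ (hermHull q C : Set (Fin n → F)))) δ) :
    ∃ Q : EAQECC q n κ c, Q.HasParamsOf δ C := by
  classical
  obtain ⟨K, _, _, _, ε, hcard, hε⟩ := hq.exists_coordinates hF
  let σ : Fin q ≃ K := Fintype.equivOfCardEq (by rw [Fintype.card_fin, hcard])
  obtain ⟨ψ, hψ⟩ : ∃ ψ : AddChar K ℂ, ψ.IsPrimitive := by
    obtain ⟨ψ, h⟩ := AddChar.exists_apply_ne_zero.2 (one_ne_zero (α := K))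
    exact ⟨ψ, AddChar.IsPrimitive.of_ne_one (AddChar.ne_one_iff.2 ⟨1, h⟩)⟩
  have : Nonempty (Fin n → Fin q) := ⟨fun _ => ⟨0, hq.pos⟩⟩
  obtain ⟨hdd, hdim⟩ := hermDual_spec hq hF C
  have hHull : Module.finrank K ↥(C.restrictScalars K ⊓ (hermDual q C).restrictScalars K) =
      2 * Module.finrank F (hermHull q C) := by
    rw [← finrank_restrictScalars_of_coordinates ε]
    rfl
  have hfr : ∀ D : Submodule F (Fin n → F), Module.finrank K (D.restrictScalars K) =
      2 * Module.finrank F D :=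
    finrank_restrictScalars_of_coordinates ε
  obtain ⟨V, hV, hzero, hne⟩ := (qudits n σ hψ ε).exists_encoding
    (Φ := Fin κ → Fin q) (E := Fin c → Fin q)
    (C.restrictScalars K) ((hermDual q C).restrictScalars K)
    (fun v => hε n C v) (fun v => by
      have := hε n (hermDual q C) v
      rwa [hdd] at this)
    (c := c) (κ := κ) (by simp [hcard]) (by simp [hcard])
    (by rw [hHull, hfr]; omega) (by rw [hHull, hfr]; omega)
  change ∀ v, v ∉ hermDual q C ∨ v ∈ C → ∃ z : ℂ, ∀ φ φ', ∑ e, star (V φ e) ⬝ᵥ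
    weylOp σ ψ ε v (V φ' e) = if φ = φ' then z else 0 at hzero
  change ∀ v ∈ hermDual q C, v ∉ C → ¬ ∃ z : ℂ, ∀ φ φ', ∑ e, star (V φ e) ⬝ᵥ
    weylOp σ ψ ε v (V φ' e) = if φ = φ' then z else 0 at hne
  let Q : EAQECC q n κ c := {
    V := Matrix.of fun x p => V p.1 p.2 x
    isometry := by
      ext ⟨φ, e⟩ ⟨φ', e'⟩
      rw [Matrix.mul_apply, Matrix.one_apply]
      simp only [Prod.mk.injEq]
      rw [← hV φ e φ' e']
      rfl }
  have hQ : ∀ (M : Matrix (Fin n → Fin q) (Fin n → Fin q) ℂ) (φ φ' : Fin κ → Fin q),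
      (Q.encode.conjTranspose * (M ⊗ₖ (1 : Matrix (Fin c → Fin q) (Fin c → Fin q) ℂ)) *
        Q.encode) φ φ' = ((q : ℂ) ^ c)⁻¹ * ∑ e, star (V φ e) ⬝ᵥ M.mulVec (V φ' e) :=
    fun M φ φ' => Q.encode_conj_apply M φ φ'
  refine ⟨Q, by rw [hc]; push_cast; ring, by omega, hδ, ?_, ?_⟩
  · intro T hT A
    obtain ⟨a, ha⟩ := localOp_mulVec_eq_sum (σ := σ) hψ ε A
    have hloc : ∀ v : (T → K) × (T → K), ∃ z : ℂ, ∀ φ φ', ∑ e, star (V φ e) ⬝ᵥ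
        weylOp σ ψ ε (localVec ε T v.1 v.2) (V φ' e) = if φ = φ' then z else 0 := by
      intro v
      apply hzero
      -- An exception would be a word of the dual outside the hull, supported on fewer than `δ`
      -- positions.
      by_contra! hcon
      have hmem : localVec ε T v.1 v.2 ∈
          (hermDual q C : Set (Fin n → F)) \ (hermHull q C : Set (Fin n → F)) :=
        ⟨hcon.1, fun h => hcon.2 h.1⟩
      have hle := hδ.2 ⟨_, hmem, fun h => hcon.2 (h ▸ C.zero_mem), rfl⟩
      have hsub : {i | localVec ε T v.1 v.2 i ≠ 0} ⊆ (T : Set (Fin n)) := fun i hi => by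
        by_contra hiT
        exact hi (localVec_eq_zero ε T v.1 v.2 hiT)
      have := Set.ncard_le_ncard hsub (Set.toFinite _)
      rw [Set.ncard_coe_finset] at this
      omega
    choose z hz using hloc
    refine ⟨((q : ℂ) ^ c)⁻¹ * ∑ v, a v * z v, ?_⟩
    ext φ φ'
    rw [hQ, Matrix.smul_apply, Matrix.one_apply, smul_eq_mul, mul_assoc]
    congr 1
    simp only [ha, dotProduct_sum, dotProduct_smul, smul_eq_mul]
    rw [Finset.sum_comm, Finset.sum_mul]
    refine Finset.sum_congr rfl fun v _ => ?_
    rw [← Finset.mul_sum, hz, mul_assoc, mul_ite (φ = φ') (z v), mul_one, mul_zero]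
  · intro hdet
    -- The Weyl operator of a word of least weight is an undetected error on exactly `δ` qudits.
    obtain ⟨v, ⟨hvC', hvC⟩, -, hv⟩ := hδ.1
    obtain ⟨A, hA⟩ := exists_localOp_eq_weylOp σ ψ ε
      (T := Finset.univ.filter fun i => v i ≠ 0) (v := v) (by simp)
    obtain ⟨z, hz⟩ := hdet (Finset.univ.filter fun i => v i ≠ 0) (by
      rw [← hv, ← Set.ncard_coe_finset]
      simp) A
    refine hne v hvC' (fun h => hvC ⟨h, hvC'⟩) ⟨(q : ℂ) ^ c * z, fun φ φ' => ?_⟩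
    have h := congrFun (congrFun hz φ) φ'
    rw [hQ, Matrix.smul_apply, Matrix.one_apply, smul_eq_mul, mul_ite, mul_one, mul_zero,
      inv_mul_eq_iff_eq_mul₀ (pow_ne_zero _ (by exact_mod_cast hq.ne_zero))] at h
    simp only [hA] at h
    rw [h, mul_ite, mul_zero]

end Construction

/-! ### Generalized Reed-Solomon codes -/

section GRS

open Polynomial

variable {F : Type*} [Field F] {n k : ℕ} {b a : Fin n → F}

theorem mem_grsCode {u : Fin n → F} :
    u ∈ grsCode k b a ↔ ∃ f ∈ degreeLT F k, ∀ i, a i * f.eval (b i) = u i := by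
  simp only [grsCode, Submodule.mem_map, funext_iff]
  rfl

theorem eq_zero_of_mem_degreeLT {f : F[X]} (hb : Function.Injective b) (hf : f ∈ degreeLT F k)
    {s : Finset (Fin n)} (hs : k ≤ s.card) (h : ∀ i ∈ s, f.eval (b i) = 0) : f = 0 :=
  Polynomial.eq_zero_of_degree_lt_of_eval_index_eq_zero s hb.injOn
    ((mem_degreeLT.1 hf).trans_le (by exact_mod_cast hs)) h

theorem finrank_degreeLT (F : Type*) [Field F] (k : ℕ) : Module.finrank F (degreeLT F k) = k := by
  rw [(degreeLTEquiv F k).finrank_eq, Module.finrank_fin_fun]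

instance (F : Type*) [Field F] (k : ℕ) : Module.Finite F (degreeLT F k) :=
  Module.Finite.equiv (degreeLTEquiv F k).symm

/-- The evaluation map on the polynomials of degree less than `k`. -/
noncomputable def grsEval (k : ℕ) (b a : Fin n → F) : degreeLT F k →ₗ[F] (Fin n → F) :=
  (LinearMap.pi fun i => a i • Polynomial.leval (b i)).domRestrict (degreeLT F k)

theorem grsEval_apply (f : degreeLT F k) (i : Fin n) :
    grsEval k b a f i = a i * (f : F[X]).eval (b i) := rfl

theorem range_grsEval (k : ℕ) (b a : Fin n → F) : (grsEval k b a).range = grsCode k b a :=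
  LinearMap.range_domRestrict _ _

theorem grsEval_injective (hb : Function.Injective b) (ha : ∀ i, a i ≠ 0) (hk : k ≤ n) :
    Function.Injective (grsEval k b a) := by
  rw [← LinearMap.ker_eq_bot, LinearMap.ker_eq_bot']
  intro f hf
  refine Subtype.ext (eq_zero_of_mem_degreeLT hb f.2 (s := Finset.univ) (by simpa using hk) ?_)
  intro i _
  exact (mul_eq_zero.1 (congrFun hf i)).resolve_left (ha i)

theorem finrank_grsCode (hb : Function.Injective b) (ha : ∀ i, a i ≠ 0) (hk : k ≤ n) :
    Module.finrank F (grsCode k b a) = k := by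
  rw [← range_grsEval, LinearMap.finrank_range_of_inj (grsEval_injective hb ha hk),
    finrank_degreeLT]

/-- A nonzero polynomial of degree less than `k` has at most `k - 1` roots among the distinct
points. -/
theorem le_weight_of_mem_grsCode (hb : Function.Injective b) {u : Fin n → F}
    (hu : u ∈ grsCode k b a) (hu0 : u ≠ 0) (ha : ∀ i, a i ≠ 0) :
    n + 1 ≤ Set.ncard {i | u i ≠ 0} + k := by
  classical
  obtain ⟨f, hf, hfu⟩ := mem_grsCode.1 hu
  by_contra! hlt
  have h1 : Set.ncard {i | u i ≠ 0} = (Finset.univ.filter fun i => u i ≠ 0).card := by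
    rw [← Set.ncard_coe_finset]
    simp
  have h2 := Finset.card_filter_add_card_filter_not (s := Finset.univ) fun i => u i ≠ 0
  rw [Finset.card_univ, Fintype.card_fin] at h2
  have hf0 : f = 0 := by
    refine eq_zero_of_mem_degreeLT hb hf (s := Finset.univ.filter fun i => ¬ u i ≠ 0) (by omega) ?_
    intro i hi
    have hi : u i = 0 := by simpa using hi
    rw [← hfu] at hi
    exact (mul_eq_zero.1 hi).resolve_left (ha i)
  apply hu0
  ext i
  rw [← hfu, hf0, eval_zero, mul_zero, Pi.zero_apply]

/-- The words of minimum weight span a generalized Reed-Solomon code, so that the minimum weight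
is attained outside every proper subspace. -/
theorem isLeast_weightSet_grsCode (hb : Function.Injective b) (ha : ∀ i, a i ≠ 0) (hk : k ≤ n)
    (hk0 : 0 < k) {R : Submodule F (Fin n → F)} (hR : ¬ grsCode k b a ≤ R) :
    IsLeast (weightSet ((grsCode k b a : Set (Fin n → F)) \ (R : Set (Fin n → F)))) (n - k + 1) := by
  classical
  refine ⟨?_, ?_⟩
  -- The Lagrange basis on `k` nodes spans the code, and each member vanishes at `k - 1` nodes. One
  -- of them must lie outside `R`.
  · obtain ⟨s, -, hs⟩ := Finset.exists_subset_card_eq (s := (Finset.univ : Finset (Fin n)))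
      (n := k) (by simpa using hk)
    have hmem : ∀ i ∈ s, Lagrange.basis s b i ∈ degreeLT F k := fun i hi => by
      rw [mem_degreeLT, Lagrange.degree_basis hb.injOn hi, hs]
      exact_mod_cast Nat.sub_lt hk0 one_pos
    obtain ⟨i, hi, hiR⟩ : ∃ i ∈ s, (fun j => a j * (Lagrange.basis s b i).eval (b j)) ∉ R := by
      by_contra! hcon
      apply hR
      intro u hu
      obtain ⟨f, hf, hfu⟩ := mem_grsCode.1 hu
      have hfs : f = Lagrange.interpolate s b fun i => f.eval (b i) :=
        Lagrange.eq_interpolate hb.injOn (by rw [hs]; exact mem_degreeLT.1 hf)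
      have : u = ∑ i ∈ s, f.eval (b i) •
          (fun j => a j * (Lagrange.basis s b i).eval (b j) : Fin n → F) := by
        ext j
        rw [← hfu j]
        conv_lhs => rw [hfs]
        rw [Lagrange.interpolate_apply, eval_finsetSum, Finset.mul_sum, Finset.sum_apply]
        refine Finset.sum_congr rfl fun i _ => ?_
        rw [eval_mul, eval_C, Pi.smul_apply, smul_eq_mul]
        ring
      rw [this]
      exact R.sum_mem fun i hi => R.smul_mem _ (hcon i hi)
    set u : Fin n → F := fun j => a j * (Lagrange.basis s b i).eval (b j) with hu
    have hu0 : u ≠ 0 := fun h => hiR (h ▸ R.zero_mem)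
    have huC : u ∈ grsCode k b a := mem_grsCode.2 ⟨_, hmem i hi, fun _ => rfl⟩
    refine ⟨u, ⟨huC, hiR⟩, hu0, ?_⟩
    have h1 := le_weight_of_mem_grsCode hb huC hu0 ha
    have h2 : {j | u j ≠ 0} ⊆ ((s.erase i)ᶜ : Finset (Fin n)) := by
      intro j hj
      rw [Finset.mem_coe, Finset.mem_compl, Finset.mem_erase]
      rintro ⟨hji, hjs⟩
      exact hj (by rw [hu]; simp only [Lagrange.eval_basis_of_ne hji.symm hjs, mul_zero])
    have h3 := Set.ncard_le_ncard h2 (Set.toFinite _)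
    rw [Set.ncard_coe_finset, Finset.card_compl, Fintype.card_fin, Finset.card_erase_of_mem hi,
      hs] at h3
    omega
  · rintro w ⟨u, ⟨hu, -⟩, hu0, rfl⟩
    have := le_weight_of_mem_grsCode hb hu hu0 ha
    omega

theorem mul_mem_degreeLT {l : ℕ} {f g : F[X]} (hf : f ∈ degreeLT F k) (hg : g ∈ degreeLT F l)
    (hkl : k + l ≤ n + 1) : f * g ∈ degreeLT F n := by
  rw [mem_degreeLT] at *
  by_cases hf0 : f = 0
  · rw [hf0, zero_mul, degree_zero]
    exact WithBot.bot_lt_coe _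
  by_cases hg0 : g = 0
  · rw [hg0, mul_zero, degree_zero]
    exact WithBot.bot_lt_coe _
  rw [degree_mul, degree_eq_natDegree hf0, degree_eq_natDegree hg0] at *
  norm_cast at *
  omega

/-- The Hermitian dual of a generalized Reed-Solomon code is a generalized Reed-Solomon code. -/
theorem exists_hermDual_grsCode [Fintype F] {q : ℕ} (hq : IsPrimePow q)
    (hF : Fintype.card F = q ^ 2) (hb : Function.Injective b) (ha : ∀ i, a i ≠ 0) (hk : k ≤ n) :
    ∃ b' a' : Fin n → F, Function.Injective b' ∧ (∀ i, a' i ≠ 0) ∧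
      hermDual q (grsCode k b a) = grsCode (n - k) b' a' := by
  obtain ⟨φ, hφ⟩ := hq.exists_frobenius hF
  have hb' : Function.Injective fun i => φ (b i) := φ.injective.comp hb
  -- With these multipliers the Hermitian product of two words is the Lagrange formula for the
  -- coefficient of degree `n - 1` of `g * f.map φ`, whose degree is at most `n - 2`.
  let w : Fin n → F := fun i =>
    (φ (a i) * ∏ j ∈ Finset.univ.erase i, (φ (b i) - φ (b j)))⁻¹
  have hw : ∀ i, w i ≠ 0 := by
    intro i
    refine inv_ne_zero (mul_ne_zero ((map_ne_zero φ).2 (ha i)) (Finset.prod_ne_zero_iff.2 ?_))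
    intro j hj
    exact sub_ne_zero.2 fun h => (Finset.ne_of_mem_erase hj) (hb' h).symm
  refine ⟨fun i => φ (b i), w, hb', hw, ?_⟩
  symm
  apply Submodule.eq_of_le_of_finrank_eq
  · intro u hu v hv
    obtain ⟨g, hg, hgu⟩ := mem_grsCode.1 hu
    obtain ⟨f, hf, hfv⟩ := mem_grsCode.1 hv
    have hfφ : f.map φ ∈ degreeLT F k := by
      rw [mem_degreeLT] at *
      rwa [degree_map]
    rcases Nat.eq_zero_or_pos n with rfl | hn
    · simp [hermInner]
    have hP : g * f.map φ ∈ degreeLT F (n - 1) := mul_mem_degreeLT hg hfφ (by omega)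
    have hPn := mem_degreeLT.1 hP
    have h := Lagrange.coeff_eq_sum (s := Finset.univ) hb'.injOn (P := g * f.map φ)
      (hPn.trans_le (by simp))
    rw [Finset.card_univ, Fintype.card_fin, coeff_eq_zero_of_degree_lt hPn] at h
    rw [h, hermInner]
    refine Finset.sum_congr rfl fun i _ => ?_
    rw [← hgu, ← hfv, ← hφ, map_mul, eval_mul, eval_map_apply, div_eq_mul_inv]
    have hai : φ (a i) ≠ 0 := (map_ne_zero φ).2 (ha i)
    simp only [w, mul_inv]
    field_simp
  · rw [finrank_grsCode hb' hw (by omega)]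
    have := (hermDual_spec hq hF (grsCode k b a)).2
    rw [finrank_grsCode hb ha hk] at this
    omega

/-- The dimension of the Hermitian hull of a generalized Reed-Solomon code whose Gram matrix
is diagonalized by independent functionals. -/
theorem finrank_hermHull_grsCode [Fintype F] {q : ℕ} (hq : IsPrimePow q)
    (hb : Function.Injective b) (ha : ∀ i, a i ≠ 0) (hk : k ≤ n) {J : Type*} [Fintype J]
    (Φ : F[X] →ₗ[F] (J → F)) (c : J → F) (hc : ∀ j, c j ≠ 0)
    (hΦ : ∀ t : J → F, ∃ f ∈ degreeLT F k, Φ f = t)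
    (hform : ∀ f ∈ degreeLT F k, ∀ g ∈ degreeLT F k,
      ∑ i, (a i * f.eval (b i)) * (a i * g.eval (b i)) ^ q = ∑ j, c j * Φ f j * Φ g j ^ q) :
    Module.finrank F (hermHull q (grsCode k b a)) + Fintype.card J = k := by
  classical
  -- Testing against a polynomial that `Φ` sends to a unit vector isolates one coordinate of `Φ f`,
  -- so the hull is the image of the kernel of `Φ`.
  have hhull : hermHull q (grsCode k b a) =
      (LinearMap.ker (Φ.domRestrict (degreeLT F k))).map (grsEval k b a) := by
    ext u
    rw [mem_hermHull, mem_hermDual, Submodule.mem_map]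
    constructor
    · rintro ⟨hu, hdual⟩
      obtain ⟨f, hf, hfu⟩ := mem_grsCode.1 hu
      refine ⟨⟨f, hf⟩, ?_, funext hfu⟩
      rw [LinearMap.mem_ker, LinearMap.domRestrict_apply]
      ext j
      obtain ⟨g, hg, hgj⟩ := hΦ (Pi.single j 1)
      have h := hdual _ (mem_grsCode.2 ⟨g, hg, fun _ => rfl⟩)
      rw [hermInner] at h
      simp only [← hfu] at h
      rw [hform f hf g hg, hgj, Finset.sum_eq_single j] at h
      · simpa [hc j] using h
      · intro l _ hl
        rw [Pi.single_eq_of_ne hl, zero_pow hq.ne_zero, mul_zero]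
      · simp
    · rintro ⟨⟨f, hf⟩, hfΦ, rfl⟩
      rw [LinearMap.mem_ker, LinearMap.domRestrict_apply] at hfΦ
      refine ⟨mem_grsCode.2 ⟨f, hf, fun _ => rfl⟩, fun v hv => ?_⟩
      obtain ⟨g, hg, hgv⟩ := mem_grsCode.1 hv
      rw [hermInner]
      simp only [← hgv, grsEval_apply]
      rw [hform f hf g hg, hfΦ]
      simp
  have hsurj : Function.Surjective (Φ.domRestrict (degreeLT F k)) := fun t =>
    let ⟨f, hf, h⟩ := hΦ t
    ⟨⟨f, hf⟩, h⟩
  have h := (Φ.domRestrict (degreeLT F k)).finrank_range_add_finrank_ker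
  rw [LinearMap.range_eq_top.2 hsurj, finrank_top, Module.finrank_fintype_fun_eq_card,
    finrank_degreeLT] at h
  rw [hhull, ← (Submodule.equivMapOfInjective _ (grsEval_injective hb ha hk) _).finrank_eq]
  omega

end GRS

/-! ### Optimal parameters from the dimension of the hull -/

section OptimalCodes

universe u

variable {q n : ℕ} {F : Type u} [Field F] [Fintype F]

theorem IsGRS.hermDual {C : Submodule F (Fin n → F)} (hC : IsGRS C) (hq : IsPrimePow q)
    (hF : Fintype.card F = q ^ 2) : IsGRS (hermDual q C) := by
  obtain ⟨k, hk, b, a, hb, ha, rfl⟩ := hC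
  obtain ⟨b', a', hb', ha', h⟩ := exists_hermDual_grsCode hq hF hb ha hk
  exact ⟨n - k, Nat.sub_le _ _, b', a', hb', ha', h⟩

/-- The dual is MDS of dimension `n - k`, with least weight `k + 1`. The condition `k + r < n` says
that the hull is smaller than the dual, so this weight occurs outside the hull. -/
theorem existsOptimalEAQECC_of_hull (hq : IsPrimePow q) (hF : Fintype.card F = q ^ 2)
    {C : Submodule F (Fin n → F)} (hC : IsGRS C) {k r : ℕ} (hk : Module.finrank F C = k)
    (hr : Module.finrank F (hermHull q C) = r) (hlt : k + r < n) :
    ExistsOptimalEAQECC F q n (n - k - r) (k + 1) (k - r) := by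
  have hrk : r ≤ k := by
    rw [← hk, ← hr]
    exact Submodule.finrank_mono inf_le_left
  refine ⟨n, n - k - r, k + 1, k - r, rfl, by omega, by push_cast; rfl, by omega,
    ⟨C, hC, ?_⟩, by ring⟩
  refine exists_hasParamsOf hq hF C (by omega) (by omega) ?_
  have hd := (hermDual_spec hq hF C).2
  obtain ⟨l, hl, b, a, hb, ha, h⟩ := hC.hermDual hq hF
  rw [h, finrank_grsCode hb ha hl] at hd
  rw [h, show k + 1 = n - l + 1 by omega]
  refine isLeast_weightSet_grsCode hb ha hl (by omega) fun hle => ?_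
  have := Submodule.finrank_mono hle
  rw [finrank_grsCode hb ha hl] at this
  omega

/-- A code and its Hermitian dual have the same hull. -/
theorem existsOptimalEAQECC_of_hull_dual (hq : IsPrimePow q) (hF : Fintype.card F = q ^ 2)
    {C : Submodule F (Fin n → F)} (hC : IsGRS C) {k r : ℕ} (hk : Module.finrank F C = k)
    (hr : Module.finrank F (hermHull q C) = r) (hlt : r < k) :
    ExistsOptimalEAQECC F q n (k - r) (n - k + 1) (n - k - r) := by
  obtain ⟨hdd, hd⟩ := hermDual_spec hq hF C
  have hhull : hermHull q (hermDual q C) = hermHull q C := by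
    rw [hermHull, hdd, hermHull, inf_comm]
  have h := existsOptimalEAQECC_of_hull hq hF (hC.hermDual hq hF) (k := n - k) (r := r)
    (by omega) (by rw [hhull, hr]) (by omega)
  have hkn : ((n - k : ℕ) : ℤ) = n - k := by omega
  rw [hkn] at h
  convert h using 1
  ring

end OptimalCodes

/-! ### Four codes from one nonvanishing moment -/

section Families

open Polynomial

universe u

variable {q : ℕ} {F : Type u} [Field F] [Fintype F]

/-- The norm to the subfield with `q` elements is surjective. -/
theorem exists_pow_succ_eq (hq : IsPrimePow q) (hF : Fintype.card F = q ^ 2) {h : F} (h0 : h ≠ 0)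
    (hh : h ^ q = h) : ∃ a : F, a ≠ 0 ∧ a ^ (q + 1) = h := by
  classical
  have hq1 := hq.one_lt
  obtain ⟨g, hg⟩ := IsCyclic.exists_generator (α := Fˣ)
  obtain ⟨t, ht⟩ := (mem_powers_iff_mem_zpowers).2 (hg (Units.mk0 h h0))
  have ht' : g ^ t = Units.mk0 h h0 := ht
  -- Since `h` is fixed by Frobenius, `(q + 1) * (q - 1)` divides `t * (q - 1)`, so `h` is a `(q +
  -- 1)`-st power.
  have hpow : g ^ (t * (q - 1)) = 1 := by
    rw [pow_mul, ht']
    ext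
    rw [Units.val_pow_eq_pow_val, Units.val_mk0, Units.val_one]
    apply mul_right_cancel₀ h0
    rw [← pow_succ, Nat.sub_add_cancel hq1.le, one_mul, hh]
  have hord := orderOf_dvd_of_pow_eq_one hpow
  rw [orderOf_eq_card_of_forall_mem_zpowers hg, Nat.card_eq_fintype_card, Fintype.card_units, hF,
    Nat.sq_sub_one_eq hq1] at hord
  obtain ⟨m, rfl⟩ := Nat.dvd_of_mul_dvd_mul_right (by omega) hord
  refine ⟨(g ^ m : Fˣ), Units.ne_zero _, ?_⟩
  rw [← Units.val_pow_eq_pow_val, ← pow_mul, mul_comm, ht', Units.val_mk0]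

/-- The Hermitian form of two polynomials in terms of moments of which only one does not vanish. -/
theorem sum_eval_mul_eval_pow (hq : IsPrimePow q) (hF : Fintype.card F = q ^ 2) (X : Finset F)
    (h : F → F) {k d : ℕ} (hd : d < k) {c₀ : F}
    (hM : ∀ a < k, ∀ b < k, ∑ x ∈ X, h x * x ^ (a + q * b) = if a = d ∧ b = d then c₀ else 0)
    {f g : F[X]} (hf : f ∈ degreeLT F k) (hg : g ∈ degreeLT F k) :
    ∑ x ∈ X, h x * f.eval x * g.eval x ^ q = c₀ * f.coeff d * g.coeff d ^ q := by
  obtain ⟨φ, hφ⟩ := hq.exists_frobenius hF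
  have hexp : ∀ x, h x * f.eval x * g.eval x ^ q = ∑ a ∈ Finset.range k, ∑ b ∈ Finset.range k,
      f.coeff a * g.coeff b ^ q * (h x * x ^ (a + q * b)) := by
    intro x
    have hsum : ∀ p ∈ degreeLT F k, p.eval x = ∑ a ∈ Finset.range k, p.coeff a * x ^ a := by
      intro p hp
      by_cases hp0 : p = 0
      · simp [hp0]
      · rw [mem_degreeLT, ← natDegree_lt_iff_degree_lt hp0] at hp
        exact eval_eq_sum_range' hp x
    rw [hsum f hf, ← hφ, hsum g hg, map_sum, mul_assoc, Finset.sum_mul_sum, Finset.mul_sum]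
    refine Finset.sum_congr rfl fun a _ => ?_
    rw [Finset.mul_sum]
    refine Finset.sum_congr rfl fun b _ => ?_
    rw [hφ, mul_pow, pow_add, ← pow_mul, mul_comm b q]
    ring
  simp only [hexp]
  rw [Finset.sum_comm, Finset.sum_eq_single d]
  · rw [Finset.sum_comm, Finset.sum_eq_single d]
    · rw [← Finset.mul_sum, hM d hd d hd, if_pos ⟨rfl, rfl⟩]
      ring
    · intro b hb hbd
      rw [← Finset.mul_sum, hM d hd b (Finset.mem_range.1 hb), if_neg fun h => hbd h.2, mul_zero]
    · simp [hd]
  · intro a ha had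
    rw [Finset.sum_comm]
    refine Finset.sum_eq_zero fun b hb => ?_
    rw [← Finset.mul_sum, hM a (Finset.mem_range.1 ha) b (Finset.mem_range.1 hb),
      if_neg fun h => had h.1, mul_zero]
  · simp [hd]

/-- Puncturing and shortening a generalized Reed-Solomon code with a Gram matrix of rank one
in `s` positions, together with the Hermitian duals. -/
theorem existsOptimalEAQECC_of_moments (hq : IsPrimePow q) (hF : Fintype.card F = q ^ 2)
    (X : Finset F) (h : F → F) (h0 : ∀ x ∈ X, h x ≠ 0) (hh : ∀ x ∈ X, h x ^ q = h x)
    {k d : ℕ} {c₀ : F} (hc₀ : c₀ ≠ 0)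
    (hM : ∀ a < k, ∀ b < k, ∑ x ∈ X, h x * x ^ (a + q * b) = if a = d ∧ b = d then c₀ else 0)
    (hd : d + 1 = k ∨ d = 0 ∧ (0 : F) ∉ X) (hk : 2 * k ≤ X.card) {s : ℕ} (hs : s < k)
    (N : ℤ) (hN : (X.card : ℤ) = N) :
    ExistsOptimalEAQECC F q (N - s) 1 (N - k + 1) (N - 2 * k + 1 + s) ∧
    ExistsOptimalEAQECC F q (N - s) (1 + s) (N - k + 1 - s) (N - 2 * k + 1) ∧
    ExistsOptimalEAQECC F q (N - s) (N - 2 * k + 1) (k + 1) (1 + s) ∧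
    ExistsOptimalEAQECC F q (N - s) (N - 2 * k + 1 + s) (k + 1 - s) 1 := by
  classical
  have hdk : d < k := by omega
  obtain ⟨S, hSX, hS⟩ := Finset.exists_subset_card_eq (s := X) (n := s) (by omega)
  have hnorm : ∀ x, ∃ a : F, x ∈ X → a ≠ 0 ∧ a ^ (q + 1) = h x := by
    intro x
    by_cases hx : x ∈ X
    · obtain ⟨a, ha⟩ := exists_pow_succ_eq hq hF (h0 x hx) (hh x hx)
      exact ⟨a, fun _ => ha⟩
    · exact ⟨0, fun hx' => absurd hx' hx⟩
  choose a ha using hnorm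
  have hYcard : (X \ S).card = X.card - s := by rw [Finset.card_sdiff_of_subset hSX, hS]
  set n := X.card - s with hn
  let e := (X \ S).equivFinOfCardEq hYcard
  let b : Fin n → F := fun i => (e.symm i : F)
  have hb : Function.Injective b := Subtype.val_injective.comp e.symm.injective
  have hbX : ∀ i, b i ∈ X := fun i => (Finset.mem_sdiff.1 (e.symm i).2).1
  have hbS : ∀ i, b i ∉ S := fun i => (Finset.mem_sdiff.1 (e.symm i).2).2
  have hsum : ∀ G : F → F, ∑ i, G (b i) = ∑ x ∈ X, G x - ∑ y ∈ S, G y := by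
    intro G
    rw [eq_sub_iff_add_eq, ← Finset.sum_sdiff hSX, ← Finset.sum_coe_sort (X \ S),
      ← e.symm.sum_comp]
  have hnorm' : ∀ i (x y : F), a (b i) * x * (a (b i) * y) ^ q = h (b i) * x * y ^ q := by
    intro i x y
    rw [← (ha _ (hbX i)).2, mul_pow, pow_succ]
    ring
  set P : F[X] := Lagrange.nodal S id with hP
  have hPS : ∀ y ∈ S, P.eval y = 0 := fun y hy => Lagrange.eval_nodal_at_node (v := id) hy
  have hPne : ∀ x ∉ S, P.eval x ≠ 0 := by
    intro x hx
    refine Lagrange.eval_nodal_not_at_node fun y hy hxy => hx ?_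
    rw [hxy]
    exact hy
  have hPdeg : P ∈ degreeLT F (s + 1) := by
    rw [mem_degreeLT, Lagrange.degree_nodal, hS]
    exact_mod_cast Nat.lt_succ_self s
  have hPmul : ∀ u ∈ degreeLT F (k - s), u * P ∈ degreeLT F k := fun u hu =>
    mul_mem_degreeLT hu hPdeg (by omega)
  -- A multiple of `P` with nonzero coefficient in degree `d` makes this coefficient independent of
  -- the values on `S`. For `d = k - 1` shift the monic `P` up to degree `d`; for `d = 0` the
  -- constant term of `P` is nonzero because `0 ∉ X`.
  obtain ⟨u, hu, hud⟩ : ∃ u ∈ degreeLT F (k - s), (u * P).coeff d ≠ 0 := by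
    rcases hd with hd | ⟨rfl, hX0⟩
    · refine ⟨Polynomial.X ^ (d - s), ?_, ?_⟩
      · rw [mem_degreeLT, degree_X_pow]
        exact_mod_cast (by omega : d - s < k - s)
      · have hm : (Polynomial.X ^ (d - s) * P).Monic :=
          (monic_X_pow _).mul (Lagrange.nodal_monic (v := id))
        have hdeg : (Polynomial.X ^ (d - s) * P).natDegree = d := by
          rw [(monic_X_pow _).natDegree_mul (Lagrange.nodal_monic (v := id)), natDegree_X_pow,
            Lagrange.natDegree_nodal, hS]
          omega
        have := hm.coeff_natDegree
        rw [hdeg] at this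
        rw [this]
        exact one_ne_zero
    · refine ⟨1, ?_, ?_⟩
      · rw [mem_degreeLT, degree_one]
        exact_mod_cast (by omega : 0 < k - s)
      · rw [one_mul, coeff_zero_eq_eval_zero]
        exact hPne 0 fun h => hX0 (hSX h)
  have hform := fun {f g : F[X]} => sum_eval_mul_eval_pow hq hF X h hdk hM (f := f) (g := g)
  -- the punctured code
  have ha1 : ∀ i, a (b i) ≠ 0 := fun i => (ha _ (hbX i)).1
  have hk1 : k ≤ n := by omega
  -- Removing `S` subtracts one rank-one term per point, so the form is diagonal in coefficient `d`
  -- and the values on `S`, with entries `c₀` and `-h y`. To prescribe all of these, interpolate on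
  -- `S` and then correct by a multiple of `u * P`.
  have hull1 := finrank_hermHull_grsCode hq hb ha1 hk1
    (LinearMap.pi fun j : Option S => j.elim (lcoeff F d) fun y => leval (y : F))
    (fun j => j.elim c₀ fun y => -h y)
    (by
      rintro (_ | y)
      · exact hc₀
      · exact neg_ne_zero.2 (h0 _ (hSX y.2)))
    (by
      intro t
      set g := Lagrange.interpolate S id fun y => if hy : y ∈ S then t (some ⟨y, hy⟩) else 0
        with hg
      have hgk : g ∈ degreeLT F k := mem_degreeLT.2 <|
        (Lagrange.degree_interpolate_lt _ Function.injective_id.injOn).trans_le (by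
          rw [hS]
          exact_mod_cast hs.le)
      refine ⟨g + ((t none - g.coeff d) / (u * P).coeff d) • (u * P),
        add_mem hgk ((degreeLT F k).smul_mem _ (hPmul u hu)), ?_⟩
      ext (_ | y)
      · change (g + ((t none - g.coeff d) / (u * P).coeff d) • (u * P)).coeff d = _
        rw [coeff_add, coeff_smul, smul_eq_mul, div_mul_cancel₀ _ hud, add_sub_cancel]
      · change (g + ((t none - g.coeff d) / (u * P).coeff d) • (u * P)).eval (y : F) = _
        rw [eval_add, eval_smul, eval_mul, hPS y y.2, mul_zero, smul_zero, add_zero, hg]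
        have := Lagrange.eval_interpolate_at_node
          (fun y => if hy : y ∈ S then t (some ⟨y, hy⟩) else 0) (v := id)
          Function.injective_id.injOn y.2
        rw [id] at this
        rw [this, dif_pos y.2])
    (by
      intro f hf g hg
      simp only [hnorm']
      rw [hsum fun x => h x * f.eval x * g.eval x ^ q, hform hf hg, Fintype.sum_option,
        sub_eq_add_neg, ← Finset.sum_neg_distrib, ← Finset.sum_coe_sort S]
      simp [leval])
  rw [Fintype.card_option, Fintype.card_coe, hS] at hull1
  have hdim1 := finrank_grsCode hb ha1 hk1
  have hgrs1 : IsGRS (grsCode k b fun i => a (b i)) := ⟨k, hk1, b, _, hb, ha1, rfl⟩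
  -- the shortened code
  have ha2 : ∀ i, a (b i) * P.eval (b i) ≠ 0 := fun i => mul_ne_zero (ha1 i) (hPne _ (hbS i))
  have hk2 : k - s ≤ n := by omega
  -- The multiplier `P` vanishes on `S`, so removing `S` costs nothing and only coefficient `d` of
  -- `f * P` enters the form.
  have hull2 := finrank_hermHull_grsCode hq hb ha2 hk2
    (LinearMap.pi fun _ : Unit => lcoeff F d ∘ₗ LinearMap.mulRight F P)
    (fun _ => c₀) (fun _ => hc₀)
    (by
      intro t
      refine ⟨(t () / (u * P).coeff d) • u, Submodule.smul_mem _ _ hu, ?_⟩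
      ext j
      change ((t () / (u * P).coeff d) • u * P).coeff d = _
      rw [smul_mul_assoc, coeff_smul, smul_eq_mul, div_mul_cancel₀ _ hud])
    (by
      intro f hf g hg
      have hcomm : ∀ i (p : F[X]), a (b i) * P.eval (b i) * p.eval (b i) =
          a (b i) * (p * P).eval (b i) := by
        intro i p
        rw [eval_mul]
        ring
      simp only [hcomm, hnorm']
      rw [hsum fun x => h x * (f * P).eval x * (g * P).eval x ^ q,
        hform (hPmul f hf) (hPmul g hg), Finset.sum_eq_zero (s := S), sub_zero]
      · simp
      · intro y hy
        rw [eval_mul, hPS y hy, mul_zero, mul_zero, zero_mul])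
  rw [Fintype.card_unit] at hull2
  have hdim2 := finrank_grsCode hb ha2 hk2
  have hgrs2 : IsGRS (grsCode (k - s) b fun i => a (b i) * P.eval (b i)) :=
    ⟨k - s, hk2, b, _, hb, ha2, rfl⟩
  have hnN : (n : ℤ) = N - s := by omega
  have e1 := existsOptimalEAQECC_of_hull_dual hq hF hgrs2 hdim2 (Nat.eq_sub_of_add_eq hull2)
    (by omega)
  have e2 := existsOptimalEAQECC_of_hull_dual hq hF hgrs1 hdim1 (Nat.eq_sub_of_add_eq hull1)
    (by omega)
  have e3 := existsOptimalEAQECC_of_hull hq hF hgrs1 hdim1 (Nat.eq_sub_of_add_eq hull1) (by omega)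
  have e4 := existsOptimalEAQECC_of_hull hq hF hgrs2 hdim2 (Nat.eq_sub_of_add_eq hull2) (by omega)
  refine ⟨?_, ?_, ?_, ?_⟩
  · convert e1 using 1 <;> omega
  · convert e2 using 1 <;> omega
  · convert e3 using 1 <;> omega
  · convert e4 using 1 <;> omega

end Families

/-! ### Power sums over the field and zeros of the weights -/

section Moments

/-- As base `q` digits, `a` and `b` give a number at most `q ^ 2 - 1`; the only multiples of `q ^ 2
- 1` in this range are the two ends. -/
theorem sq_sub_one_dvd_iff {q : ℕ} (hq : 1 < q) {a b : ℕ} (ha : a ≤ q - 1) (hb : b ≤ q - 1) :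
    q ^ 2 - 1 ∣ a + q * b ↔ a = 0 ∧ b = 0 ∨ a = q - 1 ∧ b = q - 1 := by
  obtain ⟨r, rfl⟩ : ∃ r, q = r + 1 := ⟨q - 1, by omega⟩
  simp only [Nat.add_sub_cancel] at *
  have hsq : (r + 1) ^ 2 - 1 = r + (r + 1) * r := by
    have : (r + 1) ^ 2 = r + (r + 1) * r + 1 := by ring
    omega
  rw [hsq]
  constructor
  · intro h
    have hle : a + (r + 1) * b ≤ r + (r + 1) * r :=
      Nat.add_le_add ha (Nat.mul_le_mul_left _ hb)
    rcases Nat.eq_zero_or_pos (a + (r + 1) * b) with h0 | hpos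
    · left
      rw [Nat.add_eq_zero_iff, Nat.mul_eq_zero] at h0
      omega
    · right
      have heq := Nat.le_antisymm hle (Nat.le_of_dvd hpos h)
      have h1 : (r + 1) * b = (r + 1) * r := by
        have := Nat.mul_le_mul_left (r + 1) hb
        omega
      have hbr := Nat.eq_of_mul_eq_mul_left (Nat.succ_pos r) h1
      exact ⟨by rw [h1] at heq; omega, hbr⟩
  · rintro (⟨rfl, rfl⟩ | ⟨rfl, rfl⟩)
    · simp
    · exact dvd_rfl

theorem Nat.two_mul_gcd_le {t r : ℕ} (ht : 0 < t) (htr : t < r) : 2 * t.gcd r ≤ r := by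
  obtain ⟨l, hl⟩ := Nat.gcd_dvd_right t r
  have h2 := Nat.gcd_le_left r ht
  generalize t.gcd r = j at *
  subst hl
  rcases l with _ | _ | l
  · omega
  · omega
  · nlinarith

universe u

variable {q : ℕ} {F : Type u} [Field F] [Fintype F]

/-- The power `y ^ (q + 1)` is a norm to the subfield with `q` elements. -/
theorem one_sub_pow_frobenius (hq : IsPrimePow q) (hF : Fintype.card F = q ^ 2) (t : ℕ) (y : F) :
    (1 - y ^ ((q + 1) * t)) ^ q = 1 - y ^ ((q + 1) * t) := by
  obtain ⟨φ, hφ⟩ := hq.exists_frobenius hF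
  have hy : (y ^ (q + 1)) ^ q = y ^ (q + 1) := by
    rw [pow_succ, mul_pow, pow_pow_eq_self hF, mul_comm]
  rw [← hφ, map_sub, map_one, pow_mul, map_pow, hφ, hy]

variable [DecidableEq F]

theorem sum_erase_zero_pow (hF : Fintype.card F = q ^ 2) (e : ℕ) :
    ∑ x ∈ Finset.univ.erase (0 : F), x ^ e = if q ^ 2 - 1 ∣ e then -1 else 0 := by
  rw [← hF, ← FiniteField.sum_pow_units]
  symm
  refine Finset.sum_bij (fun x _ => (x : F)) (fun x _ => by simp) (fun x _ y _ h => Units.ext h)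
    (fun x hx => ⟨Units.mk0 x (Finset.ne_of_mem_erase hx), Finset.mem_univ _, rfl⟩) fun x _ => rfl

theorem sum_univ_pow (hF : Fintype.card F = q ^ 2) (e : ℕ) :
    ∑ x : F, x ^ e = if e ≠ 0 ∧ q ^ 2 - 1 ∣ e then -1 else 0 := by
  by_cases he : e = 0
  · simp [he]
  · rw [← Finset.add_sum_erase _ _ (Finset.mem_univ (0 : F)), sum_erase_zero_pow hF, zero_pow he,
      zero_add]
    simp [he]

theorem sum_erase_zero_pow_add_mul (hq : 1 < q) (hF : Fintype.card F = q ^ 2) {a b : ℕ}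
    (ha : a ≤ q - 1) (hb : b ≤ q - 1) : ∑ x ∈ Finset.univ.erase (0 : F), x ^ (a + q * b) =
      if a = 0 ∧ b = 0 ∨ a = q - 1 ∧ b = q - 1 then -1 else 0 := by
  rw [sum_erase_zero_pow hF]
  exact if_congr (sq_sub_one_dvd_iff hq ha hb) rfl rfl

/-- Including the point `0` cancels the moment of exponent `0`, because `0 ^ 0 = 1` and the `q ^ 2`
ones sum to zero. -/
theorem sum_univ_pow_add_mul (hq : 1 < q) (hF : Fintype.card F = q ^ 2) {a b : ℕ}
    (ha : a ≤ q - 1) (hb : b ≤ q - 1) : ∑ x : F, x ^ (a + q * b) =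
      if a = q - 1 ∧ b = q - 1 then -1 else 0 := by
  rw [sum_univ_pow hF]
  refine if_congr ?_ rfl rfl
  rw [sq_sub_one_dvd_iff hq ha hb]
  constructor
  · rintro ⟨h0, ⟨rfl, rfl⟩ | h⟩
    · simp at h0
    · exact h
  · rintro ⟨rfl, rfl⟩
    exact ⟨by omega, .inr ⟨rfl, rfl⟩⟩

/-- The excluded points solve `y ^ ((q + 1) * t) = 1`, and `gcd (q ^ 2 - 1, (q + 1) * t)` equals `(q
+ 1) * gcd (q - 1, t)`. -/
theorem card_filter_one_sub_pow (hq : 1 < q) (hF : Fintype.card F = q ^ 2) {t : ℕ} (ht : 0 < t) :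
    (Finset.univ.filter fun y : F => 1 - y ^ ((q + 1) * t) ≠ 0).card + t.gcd (q - 1) * (q + 1) =
      q ^ 2 := by
  have h := Finset.card_filter_add_card_filter_not (s := Finset.univ)
    fun y : F => 1 - y ^ ((q + 1) * t) ≠ 0
  have h1 : (Finset.univ.filter fun y : F => ¬ (1 - y ^ ((q + 1) * t) ≠ 0)) =
      Finset.univ.filter fun y : F => y ≠ 0 ∧ y ^ ((q + 1) * t) = 1 := by
    ext y
    simp only [Finset.mem_filter, Finset.mem_univ, true_and, not_not, sub_eq_zero]
    constructor
    · intro hy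
      refine ⟨?_, hy.symm⟩
      rintro rfl
      rw [zero_pow (by positivity)] at hy
      exact one_ne_zero hy
    · exact fun hy => hy.2.symm
  rw [h1, Nat.card_pow_eq_one, hF, Nat.sq_sub_one_eq hq, Nat.gcd_mul_left, Finset.card_univ, hF,
    Nat.gcd_comm (q - 1), mul_comm _ (t.gcd _)] at h
  exact h

end Moments

/-! ### The four choices of points and weights -/

section Optimal

universe u

variable {q : ℕ} {F : Type u} [Field F] [Fintype F]

/-- All points with weight `1` and `k = q`: only the moment at `(q - 1, q - 1)` survives. -/
theorem existsOptimalEAQECC_univ (hq : IsPrimePow q) (hF : Fintype.card F = q ^ 2) {s : ℕ}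
    (hs : s < q) (N : ℤ) (hN : (q : ℤ) ^ 2 = N) :
    ExistsOptimalEAQECC F q (N - s) 1 (N - q + 1) (N - 2 * q + 1 + s) ∧
    ExistsOptimalEAQECC F q (N - s) (1 + s) (N - q + 1 - s) (N - 2 * q + 1) ∧
    ExistsOptimalEAQECC F q (N - s) (N - 2 * q + 1) (q + 1) (1 + s) ∧
    ExistsOptimalEAQECC F q (N - s) (N - 2 * q + 1 + s) (q + 1 - s) 1 := by
  classical
  have hq1 := hq.one_lt
  refine existsOptimalEAQECC_of_moments hq hF Finset.univ (fun _ => 1) (fun _ _ => one_ne_zero)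
    (fun _ _ => one_pow q) (d := q - 1) (c₀ := -1) (by simp) ?_ (.inl (by omega)) ?_ hs N ?_
  · intro a ha b hb
    simp only [one_mul]
    exact sum_univ_pow_add_mul hq1 hF (by omega) (by omega)
  · rw [Finset.card_univ, hF]
    nlinarith
  · rw [Finset.card_univ, hF, ← hN]
    push_cast
    rfl

/-- Without the point `0` the moment at `(0, 0)` survives, while `k < q` excludes the one at `(q -
1, q - 1)`. -/
theorem existsOptimalEAQECC_erase_zero (hq : IsPrimePow q) (hF : Fintype.card F = q ^ 2) {k s : ℕ}
    (hkq : k < q) (hs : s < k) (N : ℤ) (hN : (q : ℤ) ^ 2 - 1 = N) :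
    ExistsOptimalEAQECC F q (N - s) 1 (N - k + 1) (N - 2 * k + 1 + s) ∧
    ExistsOptimalEAQECC F q (N - s) (1 + s) (N - k + 1 - s) (N - 2 * k + 1) ∧
    ExistsOptimalEAQECC F q (N - s) (N - 2 * k + 1) (k + 1) (1 + s) ∧
    ExistsOptimalEAQECC F q (N - s) (N - 2 * k + 1 + s) (k + 1 - s) 1 := by
  classical
  have hq1 := hq.one_lt
  have hcard : ((Finset.univ.erase (0 : F)).card) + 1 = q ^ 2 := by
    rw [Finset.card_erase_add_one (Finset.mem_univ _), Finset.card_univ, hF]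
  refine existsOptimalEAQECC_of_moments hq hF (Finset.univ.erase 0) (fun _ => 1)
    (fun _ _ => one_ne_zero) (fun _ _ => one_pow q) (d := 0) (c₀ := -1) (by simp) ?_
    (.inr ⟨rfl, by simp⟩) ?_ hs N ?_
  · intro a ha b hb
    simp only [one_mul]
    rw [sum_erase_zero_pow_add_mul hq1 hF (by omega) (by omega)]
    exact if_congr (by omega) rfl rfl
  · nlinarith
  · rw [← hN]
    zify at hcard
    linarith

/-- The weight `1 - y ^ ((q + 1) * (q - k))` shifts both exponents by `q - k`, bringing the moment
at `(q - 1, q - 1)` to `(k - 1, k - 1)`. The points are where the weight is nonzero. -/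
theorem existsOptimalEAQECC_norm (hq : IsPrimePow q) (hF : Fintype.card F = q ^ 2) {k s : ℕ}
    (hk : 1 < k) (hkq : k < q) (hs : s < k) (N : ℤ)
    (hN : (q : ℤ) ^ 2 - ((k - 1).gcd (q - 1) : ℕ) * (q + 1) = N) :
    ExistsOptimalEAQECC F q (N - s) 1 (N - k + 1) (N - 2 * k + 1 + s) ∧
    ExistsOptimalEAQECC F q (N - s) (1 + s) (N - k + 1 - s) (N - 2 * k + 1) ∧
    ExistsOptimalEAQECC F q (N - s) (N - 2 * k + 1) (k + 1) (1 + s) ∧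
    ExistsOptimalEAQECC F q (N - s) (N - 2 * k + 1 + s) (k + 1 - s) 1 := by
  classical
  have hq1 := hq.one_lt
  have hcard := card_filter_one_sub_pow hq1 hF (t := q - k) (by omega)
  have hgcd : (q - k).gcd (q - 1) = (k - 1).gcd (q - 1) := by
    have : q - k = (q - 1) - (k - 1) := by omega
    rw [this, Nat.gcd_comm, Nat.gcd_self_sub_right (by omega), Nat.gcd_comm]
  rw [hgcd] at hcard
  refine existsOptimalEAQECC_of_moments hq hF
    (Finset.univ.filter fun y : F => 1 - y ^ ((q + 1) * (q - k)) ≠ 0)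
    (fun y => 1 - y ^ ((q + 1) * (q - k))) (fun y hy => (Finset.mem_filter.1 hy).2)
    (fun y _ => one_sub_pow_frobenius hq hF _ y) (d := k - 1) (c₀ := 1) one_ne_zero ?_
    (.inl (by omega)) ?_ hs N ?_
  · intro a ha b hb
    have hexp : ∀ y : F, (1 - y ^ ((q + 1) * (q - k))) * y ^ (a + q * b) =
        y ^ (a + q * b) - y ^ ((a + (q - k)) + q * (b + (q - k))) := by
      intro y
      rw [sub_mul, one_mul, ← pow_add]
      congr 2
      ring
    rw [Finset.sum_filter_of_ne fun y _ hy => left_ne_zero_of_mul hy]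
    simp only [hexp]
    rw [Finset.sum_sub_distrib, sum_univ_pow_add_mul hq1 hF (by omega) (by omega),
      sum_univ_pow_add_mul hq1 hF (by omega) (by omega), if_neg (by omega), zero_sub, neg_ite,
      neg_neg, neg_zero]
    exact if_congr (by omega) rfl rfl
  -- The gcd is a proper divisor of `q - 1`, so fewer than half of the points are lost, which leaves
  -- room for `2 * k`.
  · have h1 := Nat.two_mul_gcd_le (by omega : 0 < k - 1) (by omega : k - 1 < q - 1)
    generalize (k - 1).gcd (q - 1) = j at *
    obtain ⟨r, rfl⟩ : ∃ r, q = r + 1 := ⟨q - 1, by omega⟩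
    simp only [Nat.add_sub_cancel] at *
    nlinarith
  · rw [← hN]
    zify at hcard
    linarith

/-- Shifting exponents below `k` by `m + 1 - k` lands strictly between `0` and `q - 1`, so the
second term of the weight contributes nothing and only the moment at `(0, 0)` remains. -/
theorem existsOptimalEAQECC_norm_erase_zero (hq : IsPrimePow q) (hF : Fintype.card F = q ^ 2)
    {k m s : ℕ} (hkm : k ≤ m) (hm : m + 1 < q) (hs : s < k) (N : ℤ)
    (hN : (q : ℤ) ^ 2 - ((m + 1 - k).gcd (q - 1) : ℕ) * (q + 1) - 1 = N) :
    ExistsOptimalEAQECC F q (N - s) 1 (N - k + 1) (N - 2 * k + 1 + s) ∧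
    ExistsOptimalEAQECC F q (N - s) (1 + s) (N - k + 1 - s) (N - 2 * k + 1) ∧
    ExistsOptimalEAQECC F q (N - s) (N - 2 * k + 1) (k + 1) (1 + s) ∧
    ExistsOptimalEAQECC F q (N - s) (N - 2 * k + 1 + s) (k + 1 - s) 1 := by
  classical
  have hq1 := hq.one_lt
  have ht : 0 < m + 1 - k := by omega
  have hcard := card_filter_one_sub_pow hq1 hF ht
  have hcard' := Finset.card_erase_add_one (s := Finset.univ.filter
    fun y : F => 1 - y ^ ((q + 1) * (m + 1 - k)) ≠ 0) (a := 0) (by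
      simp only [Finset.mem_filter, Finset.mem_univ, true_and]
      rw [zero_pow (by positivity), sub_zero]
      exact one_ne_zero)
  rw [← hcard', ← Finset.filter_erase] at hcard
  refine existsOptimalEAQECC_of_moments hq hF
    ((Finset.univ.erase 0).filter fun y : F => 1 - y ^ ((q + 1) * (m + 1 - k)) ≠ 0)
    (fun y => 1 - y ^ ((q + 1) * (m + 1 - k))) (fun y hy => (Finset.mem_filter.1 hy).2)
    (fun y _ => one_sub_pow_frobenius hq hF _ y) (d := 0) (c₀ := -1) (by simp) ?_
    (.inr ⟨rfl, by simp⟩) ?_ hs N ?_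
  · intro a ha b hb
    have hexp : ∀ y : F, (1 - y ^ ((q + 1) * (m + 1 - k))) * y ^ (a + q * b) =
        y ^ (a + q * b) - y ^ ((a + (m + 1 - k)) + q * (b + (m + 1 - k))) := by
      intro y
      rw [sub_mul, one_mul, ← pow_add]
      congr 2
      ring
    rw [Finset.sum_filter_of_ne fun y _ hy => left_ne_zero_of_mul hy]
    simp only [hexp]
    rw [Finset.sum_sub_distrib, sum_erase_zero_pow_add_mul hq1 hF (by omega) (by omega),
      sum_erase_zero_pow_add_mul hq1 hF (by omega) (by omega), if_neg (c := _ ∨ _)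
      (by omega : ¬ (a + (m + 1 - k) = 0 ∧ b + (m + 1 - k) = 0 ∨
        a + (m + 1 - k) = q - 1 ∧ b + (m + 1 - k) = q - 1)), sub_zero]
    exact if_congr (by omega) rfl rfl
  · have h1 := Nat.two_mul_gcd_le ht (by omega : m + 1 - k < q - 1)
    generalize (m + 1 - k).gcd (q - 1) = j at *
    obtain ⟨r, rfl⟩ : ∃ r, q = r + 1 := ⟨q - 1, by omega⟩
    simp only [Nat.add_sub_cancel] at *
    nlinarith
  · rw [← hN]
    zify at hcard
    linarith

end Optimal

theorem theorem11 (q : ℕ) (hq : IsPrimePow q)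
    (F : Type*) [Field F] [Fintype F] (hF : Fintype.card F = q ^ 2) :
    -- families 1 to 4
    (∀ s : ℤ, 0 ≤ s → s ≤ q - 1 →
      ExistsOptimalEAQECC F q (q ^ 2 - s) 1 (q ^ 2 - q + 1) (q ^ 2 - 2 * q + 1 + s) ∧
      ExistsOptimalEAQECC F q (q ^ 2 - s) (1 + s) (q ^ 2 - q + 1 - s) (q ^ 2 - 2 * q + 1) ∧
      ExistsOptimalEAQECC F q (q ^ 2 - s) (q ^ 2 - 2 * q + 1) (q + 1) (1 + s) ∧
      ExistsOptimalEAQECC F q (q ^ 2 - s) (q ^ 2 - 2 * q + 1 + s) (q + 1 - s) 1) ∧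
    ∀ k : ℤ, 1 < k → k < q →
      -- families 5 to 8
      (∀ s : ℤ, 0 ≤ s → s ≤ k - 1 →
        ExistsOptimalEAQECC F q (q ^ 2 - 1 - s) 1 (q ^ 2 - k) (q ^ 2 - 2 * k + s) ∧
        ExistsOptimalEAQECC F q (q ^ 2 - 1 - s) (1 + s) (q ^ 2 - k - s) (q ^ 2 - 2 * k) ∧
        ExistsOptimalEAQECC F q (q ^ 2 - 1 - s) (q ^ 2 - 2 * k) (k + 1) (1 + s) ∧
        ExistsOptimalEAQECC F q (q ^ 2 - 1 - s) (q ^ 2 - 2 * k + s) (k + 1 - s) 1) ∧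
      -- families 9 to 12
      (∀ i : ℤ, i = Int.gcd (k - 1) (q - 1) → ∀ s : ℤ, 0 ≤ s → s ≤ k - 1 →
        ExistsOptimalEAQECC F q (q ^ 2 - i * (q + 1) - s) 1
          (q ^ 2 - i * (q + 1) - k + 1) (q ^ 2 - i * (q + 1) - 2 * k + 1 + s) ∧
        ExistsOptimalEAQECC F q (q ^ 2 - i * (q + 1) - s) (1 + s)
          (q ^ 2 - i * (q + 1) - k + 1 - s) (q ^ 2 - i * (q + 1) - 2 * k + 1) ∧
        ExistsOptimalEAQECC F q (q ^ 2 - i * (q + 1) - s) (q ^ 2 - i * (q + 1) - 2 * k + 1)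
          (k + 1) (1 + s) ∧
        ExistsOptimalEAQECC F q (q ^ 2 - i * (q + 1) - s) (q ^ 2 - i * (q + 1) - 2 * k + 1 + s)
          (k + 1 - s) 1) ∧
      -- families 13 to 16
      (∀ m : ℤ, k - 1 < m → m < q - 1 → ∀ j : ℤ, j = Int.gcd (m - k + 1) (q - 1) →
        ∀ s : ℤ, 0 ≤ s → s ≤ k - 1 →
        ExistsOptimalEAQECC F q (q ^ 2 - j * (q + 1) - 1 - s) 1
          (q ^ 2 - j * (q + 1) - k) (q ^ 2 - j * (q + 1) - 2 * k + s) ∧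
        ExistsOptimalEAQECC F q (q ^ 2 - j * (q + 1) - 1 - s) (1 + s)
          (q ^ 2 - j * (q + 1) - k - s) (q ^ 2 - j * (q + 1) - 2 * k) ∧
        ExistsOptimalEAQECC F q (q ^ 2 - j * (q + 1) - 1 - s) (q ^ 2 - j * (q + 1) - 2 * k)
          (k + 1) (1 + s) ∧
        ExistsOptimalEAQECC F q (q ^ 2 - j * (q + 1) - 1 - s) (q ^ 2 - j * (q + 1) - 2 * k + s)
          (k + 1 - s) 1) := by
  refine ⟨fun s hs0 hs => ?_, fun k hk hkq => ⟨fun s hs0 hs => ?_, fun i hi s hs0 hs => ?_,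
    fun m hkm hmq j hj s hs0 hs => ?_⟩⟩
  · lift s to ℕ using hs0
    exact existsOptimalEAQECC_univ hq hF (by omega) _ rfl
  · lift s to ℕ using hs0
    lift k to ℕ using by omega
    obtain ⟨h1, h2, h3, h4⟩ :=
      existsOptimalEAQECC_erase_zero hq hF (k := k) (s := s) (by omega) (by omega) _ rfl
    refine ⟨?_, ?_, ?_, ?_⟩
    · convert h1 using 1 <;> ring
    · convert h2 using 1 <;> ring
    · convert h3 using 1; ring
    · convert h4 using 1; ring
  · lift s to ℕ using hs0
    lift k to ℕ using by omega
    have hi' : i = ((k - 1).gcd (q - 1) : ℕ) := by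
      rw [hi, Int.gcd_eq_natAbs, show ((k : ℤ) - 1).natAbs = k - 1 by omega,
        show ((q : ℤ) - 1).natAbs = q - 1 by omega]
    rw [hi']
    exact existsOptimalEAQECC_norm hq hF (by omega) (by omega) (by omega) _ rfl
  · lift s to ℕ using hs0
    lift k to ℕ using by omega
    lift m to ℕ using by omega
    have hj' : j = ((m + 1 - k).gcd (q - 1) : ℕ) := by
      rw [hj, Int.gcd_eq_natAbs, show ((m : ℤ) - k + 1).natAbs = m + 1 - k by omega,
        show ((q : ℤ) - 1).natAbs = q - 1 by omega]
    rw [hj']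
    obtain ⟨h1, h2, h3, h4⟩ := existsOptimalEAQECC_norm_erase_zero hq hF (k := k) (m := m) (s := s)
      (by omega) (by omega) (by omega) _ rfl
    refine ⟨?_, ?_, ?_, ?_⟩
    · convert h1 using 1 <;> ring
    · convert h2 using 1 <;> ring
    · convert h3 using 1; ring
    · convert h4 using 1; ring
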